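/- Let $V=\langle f_1,f_2,f_3\rangle$ be a three-dimensional complex vector space and $L_k=\mathrm{Hom}(\bigwedge^kV,V)$, with the bracket of coderivations. A codifferential is a $d\in L_2$ with $[d,d]=0$, i.e. a Lie algebra structure on $V$; it defines $D=[d,\cdot]$ and the cohomology $H^k(d)=\ker(D|_{L_k})/D(L_{k-1})$. Let $\psi^{ij}_k\in L_2$ (with $i<j$) be the map sending $f_i\wedge f_j$ to $f_k$ and the other basis vectors $f_a\wedge f_b$, $a<b$, to $0$, and put $$d(\lambda:\mu)=\lambda\,\psi^{13}_1+\psi^{23}_1+\mu\,\psi^{23}_2 ,$$ also for $\lambda,\mu$ in a commutative $\mathbb C$-algebra. A deformation of $d$ with base a local $\mathbb C$-algebra $A$, with maximal ideal $\mathfrak m$ and augmentation $\epsilon:A\to A/\mathfrak m=\mathbb C$, is a $d_A\in L_2\otimes A$ with $[d_A,d_A]=0$ and $\epsilon_*(d_A)=d$. It is infinitesimal if $\mathfrak m^2=0$, and formal if $A=\varprojlim A/\mathfrak m^k$. Two structures over $A$ are equivalent if $d'=g^{-1}\circ d\circ g$ for some automorphism $g$ of $V\otimes A$; they are infinitesimally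 equivalent if $g$ can be chosen with $\epsilon_*(g)=1_V$. An infinitesimal deformation $d_A$ of $d$ is universal if for every infinitesimal deformation $d_B$ of $d$ there is a unique homomorphism $f:A\to B$ with $f_*(d_A)$ infinitesimally equivalent to $d_B$. A formal deformation $d_A$ is versal if for every formal deformation $d_B$ there is such an $f$, and miniversal if moreover $f$ is unique whenever $B$ is infinitesimal. A formal deformation $d_t$ of $d$ with base $\mathbb C[[t]]$ is a jump deformation to $d'\in L_2$ if $d_t$ is equivalent to $d'$ over an algebraic closure of $\mathbb C((t))$ while $d'$ is not equivalent to $d$. Let $\lambda,\mu\in\mathbb C$ with $\mu\neq-\lambda$, and $d=d(\lambda:\mu)$. Then: 1. $H^2(d)$ is one-dimensional, spanned by the class of $\psi^{13}_2$, and $H^3(d)=0$. 2. $d+t\,\psi^{13}_2$ over $\mathbb C[t]/(t^2)$ is a universal infinitesimal deformation of $d$. 3. $d+t\,\psi^{13}_2$ over $\mathbb C[[t]]$ (so without relations on the base) is a miniversal deformation of $d$. 4. For every $t\in\mathbb C$, and more generally for every commutative $\mathbb C$-algebra $A$ and $t\in A$, and for every $s\in\mathbb C$ (respectively $s\in A$)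 with $s^2=(\lambda-\mu)^2+4t$, the structure $d+t\,\psi^{13}_2$ is equivalent over $\mathbb C$ (respectively $A$) to $d(\alpha:\beta)$, where $\alpha=\frac{\lambda+\mu+s}2$ and $\beta=\frac{\lambda+\mu-s}2$. 5. Deformations of $d$ move along the family: for every formal deformation $d_B$ of $d$, with base $B$, there is a $b$ in the maximal ideal of $B$ such that $d+b\,\psi^{13}_2$ is infinitesimally equivalent to $d_B$; and there are a formal algebra $C$, an injective homomorphism $j:B\to C$ and an $s\in C$ with $s^2=(\lambda-\mu)^2+4j(b)$ and $\epsilon(s)=\lambda-\mu$, such that $j_*(d_B)$ is infinitesimally equivalent to $d(\alpha:\beta)$ with $\alpha=\frac{\lambda+\mu+s}2$, $\beta=\frac{\lambda+\mu-s}2$. 6. For $t,t'\in\mathbb C$, if $d+t\,\psi^{13}_2$ and $d+t'\,\psi^{13}_2$ are equivalent, then $t=t'$. 7. $d$ has no jump deformations. -/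

import Mathlib

open scoped PowerSeries LaurentSeries

universe u v

namespace LieDeform

/-- `L_k ⊗ A`, where `L_k = Hom(⋀ᵏ V, V)` and `V = ℂ³ = ⟨f₁, f₂, f₃⟩`: the alternating `k`-linear
maps on `V ⊗ A = A³` with values in `A³`. The basis vector `f_i` is `Pi.single (i - 1) 1`. -/
abbrev Cochain (A : Type u) [CommRing A] (k : ℕ) : Type u :=
  (Fin 3 → A) [⋀^Fin k]→ₗ[A] (Fin 3 → A)

section Cochains

variable {A : Type u} [CommRing A]

/-- The basis cochain `φ^I_j`, `I = (i₁ < ⋯ < i_k)`, with `φ^I_j(f_J) = δ^I_J f_j`; on arbitrary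
vectors it is the minor with columns `I`, times `f_j`. -/
noncomputable def basisCochain (A : Type u) [CommRing A] {k : ℕ} (I : Fin k → Fin 3) (j : Fin 3) :
    Cochain A k :=
  (LinearMap.toSpanSingleton A (Fin 3 → A) (Pi.single j 1)).compAlternatingMap
    ((Matrix.detRowAlternating (n := Fin k) (R := A)).compLinearMap (LinearMap.funLeft A A I))

/-- `f_* : L_k ⊗ A → L_k ⊗ B`, for a ring homomorphism `f : A → B`: apply `f` to the coefficients
of a cochain with respect to the basis `φ^I_j`. -/
noncomputable def pushforward {B : Type v} [CommRing B] (f : A →+* B) {k : ℕ} (c : Cochain A k) :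
    Cochain B k :=
  ∑ I : Fin k ↪o Fin 3, ∑ j : Fin 3,
    f (c (fun i => Pi.single (I i) 1) j) • basisCochain B (fun i => I i) j

/-- The composition `φψ ∈ L₃` of the coderivations given by `φ, ψ ∈ L₂`: the signed sum over the
unshuffles of type `(2, 1)`. -/
def comp₂₂ (φ ψ : Cochain A 2) (a b c : Fin 3 → A) : Fin 3 → A :=
  φ ![ψ ![a, b], c] - φ ![ψ ![a, c], b] + φ ![ψ ![b, c], a]

/-- The bracket `[φ, ψ] = φψ + ψφ ∈ L₃` of `φ, ψ ∈ L₂` (both have odd degree). -/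
def bracket₂₂ (φ ψ : Cochain A 2) (a b c : Fin 3 → A) : Fin 3 → A :=
  comp₂₂ φ ψ a b c + comp₂₂ ψ φ a b c

/-- The bracket `[d, φ] = dφ - φd ∈ L₂` of `d ∈ L₂` and `φ ∈ L₁`. -/
def bracket₂₁ (d : Cochain A 2) (φ : Cochain A 1) (a b : Fin 3 → A) : Fin 3 → A :=
  d ![φ ![a], b] - d ![φ ![b], a] - φ ![d ![a, b]]

/-- `d ∈ L₂` is a codifferential, that is, a Lie algebra structure: `[d, d] = 0`. -/
def IsCodifferential (d : Cochain A 2) : Prop :=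
  ∀ a b c, bracket₂₂ d d a b c = 0

/-- `η ∈ L₂` is a 2-cocycle of `d`: `D η = [d, η] = 0`. -/
def IsCocycle₂ (d η : Cochain A 2) : Prop :=
  ∀ a b c, bracket₂₂ d η a b c = 0

/-- `η ∈ L₂` is a 2-coboundary of `d`: `η = D φ = [d, φ]` for some `φ ∈ L₁`. -/
def IsCoboundary₂ (d η : Cochain A 2) : Prop :=
  ∃ φ : Cochain A 1, ∀ a b, η ![a, b] = bracket₂₁ d φ a b

/-- `θ ∈ L₃` is a 3-coboundary of `d`: `θ = D η = [d, η]` for some `η ∈ L₂`. -/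
def IsCoboundary₃ (d : Cochain A 2) (θ : Cochain A 3) : Prop :=
  ∃ η : Cochain A 2, ∀ a b c, θ ![a, b, c] = bracket₂₂ d η a b c

/-- `H²(d)` is one-dimensional, and the class of the cocycle `δ` is a basis of it. -/
def IsPrebasisH2 (d δ : Cochain ℂ 2) : Prop :=
  IsCocycle₂ d δ ∧ ¬ IsCoboundary₂ d δ ∧
    ∀ η : Cochain ℂ 2, IsCocycle₂ d η → ∃ c : ℂ, IsCoboundary₂ d (η - c • δ)

/-- `H³(d) = 0`. Every 3-cochain is a cocycle, because `L₄ = 0` in dimension three. -/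
def H3Vanishes (d : Cochain ℂ 2) : Prop :=
  ∀ θ : Cochain ℂ 3, IsCoboundary₃ d θ

/-- `g^*(d) = g⁻¹ ∘ d ∘ g` for an automorphism `g` of `V ⊗ A`. -/
def pullback (g : (Fin 3 → A) ≃ₗ[A] (Fin 3 → A)) (d : Cochain A 2) : Cochain A 2 :=
  (g.symm : (Fin 3 → A) →ₗ[A] (Fin 3 → A)).compAlternatingMap
    (d.compLinearMap (g : (Fin 3 → A) →ₗ[A] (Fin 3 → A)))

/-- `d ∼ d'` over `A`: `g^*(d) = d'` for some automorphism `g` of `V ⊗ A`. -/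
def Equivalent (d d' : Cochain A 2) : Prop :=
  ∃ g : (Fin 3 → A) ≃ₗ[A] (Fin 3 → A), pullback g d = d'

end Cochains

section Deformations

variable {A : Type u} [CommRing A] [Algebra ℂ A]

/-- `d ∼ d'` over the augmented algebra `A` by an infinitesimal automorphism, that is, an
automorphism `g` of `V ⊗ A` with `ε_*(g) = 1_V`. -/
def InfEquivalent (ε : A →ₐ[ℂ] ℂ) (d d' : Cochain A 2) : Prop :=
  ∃ g : (Fin 3 → A) ≃ₗ[A] (Fin 3 → A), (∀ x i, ε (g x i) = ε (x i)) ∧ pullback g d = d'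

/-- `A` is a formal algebra: local, with residue field `ℂ` (through the augmentation `ε`, whose
kernel is the maximal ideal `𝔪`), and `A = lim A / 𝔪ᵏ`. -/
structure IsFormalAlgebra (ε : A →ₐ[ℂ] ℂ) : Prop where
  isLocalRing : IsLocalRing A
  complete : IsAdicComplete (RingHom.ker ε) A

/-- `A` is an infinitesimal algebra: local, with residue field `ℂ` and `𝔪² = 0`. -/
structure IsInfinitesimalAlgebra (ε : A →ₐ[ℂ] ℂ) : Prop where
  isLocalRing : IsLocalRing A
  sq_eq_bot : RingHom.ker ε ^ 2 = ⊥

/-- `dA` is a deformation of `d` with base `A`: a codifferential with `ε_*(dA) = d`. (As `V` has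
finite dimension, the completed tensor product of `L₂` with a formal algebra is `L₂ ⊗ A`.) -/
structure IsDeformation (d : Cochain ℂ 2) (ε : A →ₐ[ℂ] ℂ) (dA : Cochain A 2) : Prop where
  isCodifferential : IsCodifferential dA
  augmentation : pushforward (ε : A →+* ℂ) dA = d

/-- `dA` is a universal infinitesimal deformation of `d`. The test algebras range over `Type v`.
A homomorphism between local algebras with residue field `ℂ` commutes with the augmentations. -/
def IsUniversalInfinitesimal.{u₁, v₁} {A : Type u₁} [CommRing A] [Algebra ℂ A]
    (d : Cochain ℂ 2) (ε : A →ₐ[ℂ] ℂ) (dA : Cochain A 2) : Prop :=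
  IsInfinitesimalAlgebra ε ∧ IsDeformation d ε dA ∧
    ∀ (B : Type v₁) [CommRing B] [Algebra ℂ B] (εB : B →ₐ[ℂ] ℂ) (dB : Cochain B 2),
      IsInfinitesimalAlgebra εB → IsDeformation d εB dB →
        ∃! f : A →ₐ[ℂ] B, InfEquivalent εB (pushforward (f : A →+* B) dA) dB

/-- `dA` is a versal deformation of `d`. -/
def IsVersal.{u₁, v₁} {A : Type u₁} [CommRing A] [Algebra ℂ A]
    (d : Cochain ℂ 2) (ε : A →ₐ[ℂ] ℂ) (dA : Cochain A 2) : Prop :=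
  IsFormalAlgebra ε ∧ IsDeformation d ε dA ∧
    ∀ (B : Type v₁) [CommRing B] [Algebra ℂ B] (εB : B →ₐ[ℂ] ℂ) (dB : Cochain B 2),
      IsFormalAlgebra εB → IsDeformation d εB dB →
        ∃ f : A →ₐ[ℂ] B, InfEquivalent εB (pushforward (f : A →+* B) dA) dB

/-- `dA` is a miniversal deformation of `d`: it is versal, and the homomorphism to an
infinitesimal algebra is unique. -/
def IsMiniversal.{u₁, v₁} {A : Type u₁} [CommRing A] [Algebra ℂ A]
    (d : Cochain ℂ 2) (ε : A →ₐ[ℂ] ℂ) (dA : Cochain A 2) : Prop :=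
  IsVersal.{u₁, v₁} d ε dA ∧
    ∀ (B : Type v₁) [CommRing B] [Algebra ℂ B] (εB : B →ₐ[ℂ] ℂ) (dB : Cochain B 2),
      IsInfinitesimalAlgebra εB → IsDeformation d εB dB →
        ∃! f : A →ₐ[ℂ] B, InfEquivalent εB (pushforward (f : A →+* B) dA) dB

/-- The augmentation `ℂ[[t]] → ℂ`, `t ↦ 0`. -/
noncomputable def powerSeriesAug : ℂ⟦X⟧ →ₐ[ℂ] ℂ :=
  { (PowerSeries.constantCoeff : ℂ⟦X⟧ →+* ℂ) with
    commutes' := fun r => PowerSeries.constantCoeff_C r }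

/-- The augmentation `ℂ[t]/(t²) → ℂ`, `t ↦ 0`; in `DualNumber ℂ` the class of `t` is `ε`. -/
noncomputable def dualNumberAug : DualNumber ℂ →ₐ[ℂ] ℂ :=
  TrivSqZeroExt.fstHom ℂ ℂ ℂ

/-- The homomorphism from `ℂ[[t]]` to an algebraic closure of its fraction field `ℂ((t))`. -/
noncomputable def toGeometricGenericPoint : ℂ⟦X⟧ →+* AlgebraicClosure ℂ⸨X⸩ :=
  (algebraMap ℂ⸨X⸩ (AlgebraicClosure ℂ⸨X⸩)).comp (algebraMap ℂ⟦X⟧ ℂ⸨X⸩)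

/-- `dt` is a jump deformation from `d` to `d'`: a one-parameter formal deformation of `d` that for
generic `t` is equivalent to the fixed structure `d'`, which is not equivalent to `d`. -/
def IsJumpDeformation (d d' : Cochain ℂ 2) (dt : Cochain ℂ⟦X⟧ 2) : Prop :=
  IsDeformation d powerSeriesAug dt ∧
    Equivalent (pushforward toGeometricGenericPoint dt)
      (pushforward (toGeometricGenericPoint.comp PowerSeries.C) d') ∧
    ¬ Equivalent d d'

end Deformations

section Family

variable {A : Type u} [CommRing A]

/-- The cochain `ψ^{13}_2`. -/
noncomputable def psi132 (A : Type u) [CommRing A] : Cochain A 2 :=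
  basisCochain A ![0, 2] 1

/-- The family `d(α : β) = ψ^{13}_1 α + ψ^{23}_1 + ψ^{23}_2 β`, with `α` and `β` in `A`. -/
noncomputable def dFam (α β : A) : Cochain A 2 :=
  α • basisCochain A ![0, 2] 0 + basisCochain A ![1, 2] 0 + β • basisCochain A ![1, 2] 1

/-- `d(lam : mu) + t ψ^{13}_2` over a `ℂ`-algebra `A`, with `lam` and `mu` in `ℂ` and `t` in `A`. -/
noncomputable def dDef [Algebra ℂ A] (lam mu : ℂ) (t : A) : Cochain A 2 :=
  dFam (algebraMap ℂ A lam) (algebraMap ℂ A mu) + t • psi132 A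

/-- `d(α : β)` with `α, β = (lam + mu ± s) / 2`. -/
noncomputable def dRoots [Algebra ℂ A] (lam mu : ℂ) (s : A) : Cochain A 2 :=
  dFam ((1 / 2 : ℂ) • (algebraMap ℂ A (lam + mu) + s))
    ((1 / 2 : ℂ) • (algebraMap ℂ A (lam + mu) - s))

end Family

end LieDeform

/-!
In `d = d(lam : mu)` the vectors `f₁, f₂` span an abelian ideal, on which `x ↦ [x, f₃]` acts with
trace `lam + mu ≠ 0` and with cyclic vector `f₂`. Both properties are open conditions, and the
whole theorem rests on them.

*Normal form.* Let `dB` be a deformation of `d` over a local algebra `B`, and let `θ x = tr (ad x)`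
be its trace form. As `θ f₃` is a unit, `ker θ` is free of rank two, and in terms of the structure
constants the Jacobi identity reads `θ(f₃)[f₁, f₂] + θ(f₁)[f₂, f₃] - θ(f₂)[f₁, f₃] = 0`. It follows
that `ker θ` is abelian and contains all brackets. Rescale `f₃` to have trace `-(lam + mu)` and let
`f₂'` be a lift of `f₂` to `ker θ`. In the basis `[f₂', f₃'] - mu f₂', f₂', f₃'` the
Cayley-Hamilton theorem gives `dB` the form `d + b ψ^{13}_2`. So every deformation over a local
base is infinitesimally equivalent to one of these
(`LieDeform.IsDeformation.exists_infEquivalent_dDef`), with no obstruction theory and no passage to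
a limit; completeness of `B` serves only to evaluate power series at `b`.

*Uniqueness.* For `d + t ψ^{13}_2` the Killing quadratic form is
`(lam² + mu² + 2t) / (lam + mu)²` times the square of the trace form
(`LieDeform.killing_mul_of_equivalent`). The factor is an invariant of the structure over any base,
so the parameter `t` is determined by the equivalence class
(`LieDeform.parameter_eq_of_equivalent`). This gives the uniqueness in the universal properties, and
the inequivalence of different members of the family.

*No jumps.* If a deformation over `ℂ[[t]]` becomes equivalent to a constant structure `d'` over an
algebraic closure of `ℂ((t))`, then the same invariant is constant, so `b` is a constant in the
maximal ideal, that is, `b = 0`. Thus `d` and `d'` are equivalent over an extension field of `ℂ`,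
hence over `ℂ` by the Nullstellensatz (`LieDeform.equivalent_of_equivalent_pushforward`).

*Moving along the family.* A square root `s` of `(lam - mu)² + 4t` gives the eigenvalues
`(lam + mu ± s) / 2` of the action of `f₃`, and a basis in which the structure is `d(α : β)`. If
`lam ≠ mu`, Hensel's lemma provides `s` in `B`; otherwise `s` is adjoined freely to `B`.
-/

namespace LieDeform

theorem update_pair {α : Type*} (x y z : α) : Function.update ![x, z] 1 y = ![x, y] := by
  ext i : 1; fin_cases i <;> rfl

/-! ### Cochains in coordinates -/

section Coordinates

variable {A : Type u} [CommRing A] {B : Type v} [CommRing B]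

theorem basisCochain_apply {k : ℕ} (I : Fin k → Fin 3) (j : Fin 3) (x : Fin k → Fin 3 → A) :
    basisCochain A I j x =
      (Matrix.of fun a b => x a (I b)).det • (Pi.single j 1 : Fin 3 → A) := rfl

theorem basisCochain_two_apply (i k j : Fin 3) (x y : Fin 3 → A) :
    basisCochain A ![i, k] j ![x, y] =
      (x i * y k - x k * y i) • (Pi.single j 1 : Fin 3 → A) := by
  rw [basisCochain_apply, Matrix.det_fin_two]
  simp

/-- The bilinear map underlying a 2-cochain. -/
def bilin (c : Cochain A 2) : (Fin 3 → A) →ₗ[A] (Fin 3 → A) →ₗ[A] (Fin 3 → A) :=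
  LinearMap.mk₂ A (fun x y => c ![x, y])
    (fun x x' y => by simpa using c.map_vecCons_add ![y] x x')
    (fun a x y => by simpa using c.map_vecCons_smul ![y] a x)
    (fun x y y' => by simpa only [update_pair] using c.map_update_add ![x, 0] 1 y y')
    (fun a x y => by simpa only [update_pair] using c.map_update_smul ![x, 0] 1 a y)

theorem bilin_apply (c : Cochain A 2) (x y : Fin 3 → A) : bilin c x y = c ![x, y] := rfl

theorem bilin_self (c : Cochain A 2) (x : Fin 3 → A) : bilin c x x = 0 :=
  c.map_eq_zero_of_eq _ (i := 0) (j := 1) rfl (by decide)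

theorem bilin_swap (c : Cochain A 2) (x y : Fin 3 → A) : bilin c y x = -bilin c x y := by
  have h := bilin_self c (x + y)
  simp only [map_add, LinearMap.add_apply, bilin_self, zero_add, add_zero] at h
  exact eq_neg_of_add_eq_zero_left h

/-- The basis vectors of `A³`. -/
abbrev e (A : Type u) [CommRing A] (i : Fin 3) : Fin 3 → A := Pi.single i 1

theorem eq_sum_e (x : Fin 3 → A) : x = x 0 • e A 0 + x 1 • e A 1 + x 2 • e A 2 := by
  ext i; fin_cases i <;> simp [e]

/-- In coordinates, a 2-cochain is a combination of the three `2 × 2` minors. -/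
theorem cochain_two_apply (c : Cochain A 2) (x y : Fin 3 → A) :
    c ![x, y] = (x 0 * y 1 - x 1 * y 0) • c ![e A 0, e A 1] +
      (x 0 * y 2 - x 2 * y 0) • c ![e A 0, e A 2] +
      (x 1 * y 2 - x 2 * y 1) • c ![e A 1, e A 2] := by
  simp only [← bilin_apply]
  conv_lhs => rw [eq_sum_e x, eq_sum_e y]
  simp only [map_add, map_smul, LinearMap.add_apply, LinearMap.smul_apply, bilin_self,
    bilin_swap c (e A 0) (e A 1), bilin_swap c (e A 0) (e A 2), bilin_swap c (e A 1) (e A 2)]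
  module

theorem cochain_two_ext {c c' : Cochain A 2} (h01 : c ![e A 0, e A 1] = c' ![e A 0, e A 1])
    (h02 : c ![e A 0, e A 2] = c' ![e A 0, e A 2])
    (h12 : c ![e A 1, e A 2] = c' ![e A 1, e A 2]) : c = c' := by
  ext v : 1
  have hv : v = ![v 0, v 1] := by ext i; fin_cases i <;> rfl
  rw [hv, cochain_two_apply c, cochain_two_apply c', h01, h02, h12]

theorem exists_cochain_two (p q r : Fin 3 → A) : ∃ c : Cochain A 2,
    c ![e A 0, e A 1] = p ∧ c ![e A 0, e A 2] = q ∧ c ![e A 1, e A 2] = r := by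
  refine ⟨∑ j, (p j • basisCochain A ![0, 1] j + q j • basisCochain A ![0, 2] j +
    r j • basisCochain A ![1, 2] j), ?_, ?_, ?_⟩ <;>
  · ext i
    simp [Fin.sum_univ_three, basisCochain_two_apply]
    fin_cases i <;> simp

theorem basisCochain_apply_single {k : ℕ} (I J : Fin k ↪o Fin 3) (j : Fin 3) :
    basisCochain A (fun i => I i) j (fun i => Pi.single (J i) 1) =
      if I = J then (Pi.single j 1 : Fin 3 → A) else 0 := by
  rw [basisCochain_apply]
  split_ifs with h
  · subst h
    have : (Matrix.of fun a b => (Pi.single (I a) 1 : Fin 3 → A) (I b)) = 1 := by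
      ext a b
      simp [Matrix.one_apply, Pi.single_apply, I.injective.eq_iff, eq_comm]
    rw [this, Matrix.det_one, one_smul]
  · -- some `J a` is not in the range of `I`, and the row of `a` vanishes
    obtain ⟨a, ha⟩ : ∃ a, J a ∉ Set.range I := by
      by_contra! hc
      have hsub : Finset.univ.image J ⊆ Finset.univ.image I := by
        intro x hx
        obtain ⟨a, -, rfl⟩ := Finset.mem_image.1 hx
        obtain ⟨b, hb⟩ := hc a
        exact Finset.mem_image.2 ⟨b, Finset.mem_univ _, hb⟩
      have heq := Finset.eq_of_subset_of_card_le hsub (by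
        rw [Finset.card_image_of_injective _ I.injective,
          Finset.card_image_of_injective _ J.injective])
      apply h
      apply OrderEmbedding.range_inj.1
      simpa using (congrArg (fun s : Finset (Fin 3) => (s : Set (Fin 3))) heq).symm
    rw [Matrix.det_eq_zero_of_row_eq_zero a, zero_smul]
    intro b
    have : I b ≠ J a := fun hb => ha ⟨b, hb⟩
    simp [Pi.single_apply, this]

theorem cochain_sum_apply {ι : Type*} {k : ℕ} (s : Finset ι) (c : ι → Cochain A k)
    (x : Fin k → Fin 3 → A) : (∑ i ∈ s, c i) x = ∑ i ∈ s, c i x := by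
  classical
  induction s using Finset.induction_on with
  | empty => simp
  | insert i s hi ih => rw [Finset.sum_insert hi, Finset.sum_insert hi, AlternatingMap.add_apply, ih]

theorem pushforward_apply_single (f : A →+* B) {k : ℕ} (c : Cochain A k) (J : Fin k ↪o Fin 3) :
    pushforward f c (fun i => Pi.single (J i) 1) =
      f ∘ c (fun i => Pi.single (J i) 1) := by
  have hsum : ∀ I : Fin k ↪o Fin 3, ∀ j : Fin 3,
      (f (c (fun i => Pi.single (I i) 1) j) • basisCochain B (fun i => I i) j)
        (fun i => Pi.single (J i) 1) =
      if I = J then Pi.single j (f (c (fun i => Pi.single (J i) 1) j)) else 0 := by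
    intro I j
    rw [AlternatingMap.smul_apply, basisCochain_apply_single]
    split_ifs with h
    · subst h
      rw [← Pi.single_smul, smul_eq_mul, mul_one]
    · rw [smul_zero]
  simp only [pushforward, cochain_sum_apply, hsum]
  rw [Finset.sum_eq_single J (fun I _ hI => by simp [hI]) (by simp)]
  simp only [if_true]
  exact Finset.univ_sum_single (f ∘ c (fun i => Pi.single (J i) 1))

theorem pushforward_two_e (f : A →+* B) (c : Cochain A 2) {i j : Fin 3} (hij : i < j) :
    pushforward f c ![e B i, e B j] = f ∘ c ![e A i, e A j] := by
  have hmono : StrictMono ![i, j] := by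
    intro a b; fin_cases a <;> fin_cases b <;> simp [hij]
  have h := pushforward_apply_single f c (OrderEmbedding.ofStrictMono ![i, j] hmono)
  have hA : (fun a => Pi.single (OrderEmbedding.ofStrictMono ![i, j] hmono a) 1 :
      Fin 2 → Fin 3 → A) = ![e A i, e A j] := by
    ext a : 1; fin_cases a <;> rfl
  have hB : (fun a => Pi.single (OrderEmbedding.ofStrictMono ![i, j] hmono a) 1 :
      Fin 2 → Fin 3 → B) = ![e B i, e B j] := by
    ext a : 1; fin_cases a <;> rfl
  rwa [hA, hB] at h

/-- Base change is compatible with evaluation at vectors with coefficients in `A`. -/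
theorem pushforward_two_comp (f : A →+* B) (c : Cochain A 2) (x y : Fin 3 → A) :
    pushforward f c ![f ∘ x, f ∘ y] = f ∘ c ![x, y] := by
  rw [cochain_two_apply c x y, cochain_two_apply _ (f ∘ x), pushforward_two_e f c (by decide),
    pushforward_two_e f c (by decide), pushforward_two_e f c (by decide)]
  ext i
  simp

theorem comp_e (f : A →+* B) (i : Fin 3) : f ∘ e A i = e B i := by
  ext j; by_cases h : j = i <;> simp [h]

theorem pushforward_pushforward {C : Type*} [CommRing C] (f : A →+* B) (g : B →+* C)
    (c : Cochain A 2) : pushforward g (pushforward f c) = pushforward (g.comp f) c := by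
  apply cochain_two_ext <;>
  · simp only [pushforward_two_e _ _ (show (0 : Fin 3) < 1 by decide),
      pushforward_two_e _ _ (show (0 : Fin 3) < 2 by decide),
      pushforward_two_e _ _ (show (1 : Fin 3) < 2 by decide)]
    rfl

theorem pushforward_id (c : Cochain A 2) : pushforward (RingHom.id A) c = c := by
  apply cochain_two_ext <;>
  · simp only [pushforward_two_e _ _ (show (0 : Fin 3) < 1 by decide),
      pushforward_two_e _ _ (show (0 : Fin 3) < 2 by decide),
      pushforward_two_e _ _ (show (1 : Fin 3) < 2 by decide)]
    rfl

end Coordinates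

/-! ### Equivalence of structures -/

section Equivalence

variable {A : Type u} [CommRing A] {B : Type v} [CommRing B]

theorem pullback_eq_iff (g : (Fin 3 → A) ≃ₗ[A] (Fin 3 → A)) (d d' : Cochain A 2) :
    pullback g d = d' ↔ ∀ x y, d ![g x, g y] = g (d' ![x, y]) := by
  have hval : ∀ x y, pullback g d ![x, y] = g.symm (d ![g x, g y]) := by
    intro x y
    have : (fun i => g (![x, y] i)) = ![g x, g y] := by
      ext i : 1; fin_cases i <;> rfl
    change g.symm (d (fun i => g (![x, y] i))) = _
    rw [this]
  constructor
  · rintro rfl x y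
    rw [hval, LinearEquiv.apply_symm_apply]
  · intro h
    apply cochain_two_ext <;> rw [hval, h, LinearEquiv.symm_apply_apply]

/-- An invertible matrix whose columns have the brackets prescribed by `d'` carries `d` to `d'`. -/
theorem exists_pullback_eq_of_matrix (P : Matrix (Fin 3) (Fin 3) A) (hP : IsUnit P.det)
    {d d' : Cochain A 2}
    (h01 : d ![P.col 0, P.col 1] = P.mulVec (d' ![e A 0, e A 1]))
    (h02 : d ![P.col 0, P.col 2] = P.mulVec (d' ![e A 0, e A 2]))
    (h12 : d ![P.col 1, P.col 2] = P.mulVec (d' ![e A 1, e A 2])) :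
    ∃ g : (Fin 3 → A) ≃ₗ[A] (Fin 3 → A), (∀ x, g x = P.mulVec x) ∧ pullback g d = d' := by
  have hg : ∀ x, Matrix.toLin'OfInv (P.nonsing_inv_mul hP) (P.mul_nonsing_inv hP) x =
      P.mulVec x := fun x => by
    simp [Matrix.toLin'OfInv]
  refine ⟨_, hg, (pullback_eq_iff _ _ _).2 fun x y => ?_⟩
  simp only [hg]
  have hcol : ∀ x, P.mulVec x = x 0 • P.col 0 + x 1 • P.col 1 + x 2 • P.col 2 := by
    intro x
    ext i
    simp [Matrix.mulVec, dotProduct, Fin.sum_univ_three, mul_comm]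
  rw [cochain_two_apply d' x y]
  simp only [Matrix.mulVec_add, Matrix.mulVec_smul, ← h01, ← h02, ← h12]
  simp only [hcol x, hcol y, ← bilin_apply]
  simp only [map_add, map_smul, LinearMap.add_apply, LinearMap.smul_apply, bilin_self,
    bilin_swap d (P.col 0) (P.col 1), bilin_swap d (P.col 0) (P.col 2),
    bilin_swap d (P.col 1) (P.col 2)]
  module

theorem Equivalent.trans {d d' d'' : Cochain A 2} (h : Equivalent d d') (h' : Equivalent d' d'') :
    Equivalent d d'' := by
  obtain ⟨g, hg⟩ := h
  obtain ⟨g', hg'⟩ := h'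
  rw [pullback_eq_iff] at hg hg'
  exact ⟨g'.trans g, (pullback_eq_iff _ _ _).2 fun x y => by
    simp only [LinearEquiv.trans_apply, hg, hg']⟩

/-- Base change of an equivalence along a ring homomorphism. -/
theorem exists_pushforward_equiv (f : A →+* B) {d d' : Cochain A 2}
    {g : (Fin 3 → A) ≃ₗ[A] (Fin 3 → A)} (hg : pullback g d = d') :
    ∃ g' : (Fin 3 → B) ≃ₗ[B] (Fin 3 → B), (∀ x, g' (f ∘ x) = f ∘ g x) ∧
      pullback g' (pushforward f d) = pushforward f d' := by
  set P := LinearMap.toMatrix' (g : (Fin 3 → A) →ₗ[A] (Fin 3 → A)) with hPdef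
  have hP : ∀ x, P.mulVec x = g x := fun x => by
    rw [hPdef, LinearMap.toMatrix'_mulVec]; rfl
  have hQ : ∀ x, (P.map f).mulVec (f ∘ x) = f ∘ g x := fun x => by
    rw [← hP]
    ext i
    exact (RingHom.map_mulVec f P x i).symm
  have hdet : IsUnit P.det := by
    rw [hPdef, LinearMap.det_toMatrix']
    exact g.isUnit_det'
  have hcol : ∀ i, (P.map f).col i = f ∘ g (e A i) := fun i => by
    rw [← hQ, comp_e, Matrix.mulVec_single_one]
  rw [pullback_eq_iff] at hg
  obtain ⟨g', hg', hd⟩ := exists_pullback_eq_of_matrix (P.map f)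
    (d := pushforward f d) (d' := pushforward f d')
    (by
      have := RingHom.map_det f P
      rw [RingHom.mapMatrix_apply] at this
      rw [← this]; exact hdet.map f)
    (by rw [hcol, hcol, pushforward_two_comp, hg, pushforward_two_e f d' (by decide), hQ])
    (by rw [hcol, hcol, pushforward_two_comp, hg, pushforward_two_e f d' (by decide), hQ])
    (by rw [hcol, hcol, pushforward_two_comp, hg, pushforward_two_e f d' (by decide), hQ])
  exact ⟨g', fun x => by rw [hg', hQ], hd⟩

theorem Equivalent.map (f : A →+* B) {d d' : Cochain A 2} (h : Equivalent d d') :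
    Equivalent (pushforward f d) (pushforward f d') := by
  obtain ⟨g, hg⟩ := h
  obtain ⟨g', -, hg'⟩ := exists_pushforward_equiv f hg
  exact ⟨g', hg'⟩

end Equivalence

section InfEquivalence

variable {A : Type u} [CommRing A] [Algebra ℂ A] {B : Type v} [CommRing B] [Algebra ℂ B]

theorem InfEquivalent.equivalent {ε : A →ₐ[ℂ] ℂ} {d d' : Cochain A 2} (h : InfEquivalent ε d d') :
    Equivalent d d' := by
  obtain ⟨g, -, hg⟩ := h
  exact ⟨g, hg⟩

theorem InfEquivalent.symm {ε : A →ₐ[ℂ] ℂ} {d d' : Cochain A 2} (h : InfEquivalent ε d d') :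
    InfEquivalent ε d' d := by
  obtain ⟨g, hε, hg⟩ := h
  rw [pullback_eq_iff] at hg
  refine ⟨g.symm, fun x i => ?_, (pullback_eq_iff _ _ _).2 fun x y => ?_⟩
  · rw [← hε, g.apply_symm_apply]
  · rw [LinearEquiv.eq_symm_apply, ← hg, g.apply_symm_apply, g.apply_symm_apply]

theorem InfEquivalent.trans {ε : A →ₐ[ℂ] ℂ} {d d' d'' : Cochain A 2} (h : InfEquivalent ε d d')
    (h' : InfEquivalent ε d' d'') : InfEquivalent ε d d'' := by
  obtain ⟨g, hε, hg⟩ := h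
  obtain ⟨g', hε', hg'⟩ := h'
  rw [pullback_eq_iff] at hg hg'
  exact ⟨g'.trans g, fun x i => by rw [LinearEquiv.trans_apply, hε, hε'],
    (pullback_eq_iff _ _ _).2 fun x y => by simp only [LinearEquiv.trans_apply, hg, hg']⟩

theorem infEquivalent_of_matrix {ε : A →ₐ[ℂ] ℂ} (P : Matrix (Fin 3) (Fin 3) A)
    (hP : IsUnit P.det) (hε : ∀ i j, ε (P i j) = (1 : Matrix (Fin 3) (Fin 3) ℂ) i j)
    {d d' : Cochain A 2}
    (h01 : d ![P.col 0, P.col 1] = P.mulVec (d' ![e A 0, e A 1]))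
    (h02 : d ![P.col 0, P.col 2] = P.mulVec (d' ![e A 0, e A 2]))
    (h12 : d ![P.col 1, P.col 2] = P.mulVec (d' ![e A 1, e A 2])) : InfEquivalent ε d d' := by
  obtain ⟨g, hg, hd⟩ := exists_pullback_eq_of_matrix P hP h01 h02 h12
  refine ⟨g, fun x i => ?_, hd⟩
  simp [hg, Matrix.mulVec, dotProduct, map_sum, hε, Matrix.one_apply]

theorem InfEquivalent.map {εA : A →ₐ[ℂ] ℂ} {εB : B →ₐ[ℂ] ℂ} (f : A →ₐ[ℂ] B)
    (hf : ∀ a, εB (f a) = εA a) {d d' : Cochain A 2} (h : InfEquivalent εA d d') :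
    InfEquivalent εB (pushforward (f : A →+* B) d) (pushforward (f : A →+* B) d') := by
  obtain ⟨g, hε, hg⟩ := h
  obtain ⟨g', hg', hd⟩ := exists_pushforward_equiv (f : A →+* B) hg
  refine ⟨g', fun x i => ?_, hd⟩
  have hbasis : ∀ j i, εB (g' (e B j) i) = εB (e B j i) := fun j i => by
    rw [← comp_e (f : A →+* B), hg']
    simp only [Function.comp_apply, RingHom.coe_coe, hf, hε]
  rw [eq_sum_e x]
  simp only [map_add, map_smul, Pi.add_apply, Pi.smul_apply, smul_eq_mul, map_mul, hbasis]

end InfEquivalence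

/-! ### Brackets and the family -/

section Brackets

variable {A : Type u} [CommRing A] {B : Type v} [CommRing B]

/-- In dimension three `L₃` has rank three, and the composition of 2-cochains is determined by
its value on `(f₁, f₂, f₃)`. -/
theorem comp₂₂_eq (φ ψ : Cochain A 2) (a b c : Fin 3 → A) :
    comp₂₂ φ ψ a b c = (Matrix.of ![a, b, c]).det •
      ((ψ ![e A 0, e A 1] 0 - ψ ![e A 1, e A 2] 2) • φ ![e A 0, e A 2] +
        (ψ ![e A 0, e A 1] 1 + ψ ![e A 0, e A 2] 2) • φ ![e A 1, e A 2] -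
        (ψ ![e A 0, e A 2] 0 + ψ ![e A 1, e A 2] 1) • φ ![e A 0, e A 1]) := by
  rw [comp₂₂, cochain_two_apply ψ a b, cochain_two_apply ψ a c, cochain_two_apply ψ b c,
    cochain_two_apply φ _ a, cochain_two_apply φ _ b, cochain_two_apply φ _ c]
  generalize ψ ![e A 0, e A 1] = p'
  generalize ψ ![e A 0, e A 2] = q'
  generalize ψ ![e A 1, e A 2] = r'
  generalize φ ![e A 0, e A 1] = p
  generalize φ ![e A 0, e A 2] = q
  generalize φ ![e A 1, e A 2] = r
  rw [Matrix.det_fin_three]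
  simp only [Matrix.of_apply, Pi.add_apply, Pi.smul_apply, smul_eq_mul, Matrix.cons_val_zero, Matrix.cons_val_one,
    Matrix.cons_val]
  module

theorem dFam_e01 (α β : A) : dFam α β ![e A 0, e A 1] = 0 := by
  ext i; fin_cases i <;> simp [dFam, basisCochain_two_apply]

theorem dFam_e02 (α β : A) : dFam α β ![e A 0, e A 2] = ![α, 0, 0] := by
  ext i; fin_cases i <;> simp [dFam, basisCochain_two_apply]

theorem dFam_e12 (α β : A) : dFam α β ![e A 1, e A 2] = ![1, β, 0] := by
  ext i; fin_cases i <;> simp [dFam, basisCochain_two_apply]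

theorem psi132_e01 : psi132 A ![e A 0, e A 1] = 0 := by
  ext i; fin_cases i <;> simp [psi132, basisCochain_two_apply]

theorem psi132_e02 : psi132 A ![e A 0, e A 2] = ![0, 1, 0] := by
  ext i; fin_cases i <;> simp [psi132, basisCochain_two_apply]

theorem psi132_e12 : psi132 A ![e A 1, e A 2] = 0 := by
  ext i; fin_cases i <;> simp [psi132, basisCochain_two_apply]

variable [Algebra ℂ A] [Algebra ℂ B]

theorem dDef_e01 (lam mu : ℂ) (t : A) : dDef lam mu t ![e A 0, e A 1] = 0 := by
  rw [dDef, AlternatingMap.add_apply, AlternatingMap.smul_apply, dFam_e01, psi132_e01]; simp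

theorem dDef_e02 (lam mu : ℂ) (t : A) :
    dDef lam mu t ![e A 0, e A 2] = ![algebraMap ℂ A lam, t, 0] := by
  rw [dDef, AlternatingMap.add_apply, AlternatingMap.smul_apply, dFam_e02, psi132_e02]; simp

theorem dDef_e12 (lam mu : ℂ) (t : A) :
    dDef lam mu t ![e A 1, e A 2] = ![1, algebraMap ℂ A mu, 0] := by
  rw [dDef, AlternatingMap.add_apply, AlternatingMap.smul_apply, dFam_e12, psi132_e12]; simp

theorem isCodifferential_dDef (lam mu : ℂ) (t : A) : IsCodifferential (dDef lam mu t) := by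
  intro a b c
  rw [bracket₂₂, comp₂₂_eq, dDef_e01, dDef_e02, dDef_e12]
  simp

theorem pushforward_dDef_ringHom {R : Type v} [CommRing R] (f : A →+* R) (lam mu : ℂ) (t : A) :
    pushforward f (dDef lam mu t) =
      dFam (f (algebraMap ℂ A lam)) (f (algebraMap ℂ A mu)) + f t • psi132 R := by
  apply cochain_two_ext <;>
    rw [pushforward_two_e f _ (by decide), AlternatingMap.add_apply, AlternatingMap.smul_apply]
  · rw [dDef_e01, dFam_e01, psi132_e01]; ext i; simp
  · rw [dDef_e02, dFam_e02, psi132_e02]; ext i; fin_cases i <;> simp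
  · rw [dDef_e12, dFam_e12, psi132_e12]; ext i; fin_cases i <;> simp

theorem pushforward_dDef (f : A →ₐ[ℂ] B) (lam mu : ℂ) (t : A) :
    pushforward (f : A →+* B) (dDef lam mu t) = dDef lam mu (f t) := by
  rw [pushforward_dDef_ringHom, dDef]
  simp

theorem dDef_zero (lam mu : ℂ) : dDef lam mu (0 : ℂ) = dFam lam mu := by
  simp [dDef]

theorem isDeformation_dDef (lam mu : ℂ) (ε : A →ₐ[ℂ] ℂ) {t : A} (ht : ε t = 0) :
    IsDeformation (dFam lam mu) ε (dDef lam mu t) :=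
  ⟨isCodifferential_dDef lam mu t, by rw [pushforward_dDef, ht, dDef_zero]⟩

/-- The eigenvalues of `ad f₃` on `⟨f₁, f₂⟩` are roots of a quadratic polynomial with
discriminant `(lam - mu)² + 4t`; a square root of it yields an eigenvector basis adapted to
`d(α : β)`. -/
theorem exists_pullback_dDef_eq_dRoots (lam mu : ℂ) (t s : A)
    (hs : s ^ 2 = algebraMap ℂ A ((lam - mu) ^ 2) + 4 * t) :
    ∃ g : (Fin 3 → A) ≃ₗ[A] (Fin 3 → A),
      (∀ x, g x = x + ((1 / 2 : ℂ) • (s - algebraMap ℂ A (lam - mu)) * x 0) • e A 1) ∧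
      pullback g (dDef lam mu t) = dRoots lam mu s := by
  set l := algebraMap ℂ A lam with hl
  set m := algebraMap ℂ A mu with hm
  set k := algebraMap ℂ A (1 / 2) with hk
  have h2 : 2 * k = 1 := by
    rw [hk, ← map_ofNat (algebraMap ℂ A) 2, ← map_mul]; norm_num
  have hs' : s ^ 2 = (l - m) ^ 2 + 4 * t := by rw [hs, map_pow, map_sub]
  set n := k * (s - (l - m)) with hn
  obtain ⟨g, hg, hd⟩ := exists_pullback_eq_of_matrix (d := dDef lam mu t)
    (d' := dRoots lam mu s) !![1, 0, 0; n, 1, 0; 0, 0, 1]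
    (by rw [Matrix.det_fin_three]; simp)
    (by
      rw [dRoots, dFam_e01, cochain_two_apply, dDef_e01, dDef_e02, dDef_e12]
      ext i; fin_cases i <;> simp [Matrix.col])
    (by
      rw [dRoots, dFam_e02, cochain_two_apply, dDef_e01, dDef_e02, dDef_e12]
      simp only [Algebra.smul_def, map_add, ← hl, ← hm, ← hk]
      ext i; fin_cases i <;> simp [Matrix.col, Matrix.mulVec, dotProduct, Fin.sum_univ_three]
      · rw [hn]; linear_combination (-l) * h2
      · rw [hn]
        linear_combination -k ^ 2 * hs' - (t * (2 * k + 1) + k * m * (s - l + m)) * h2)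
    (by
      rw [dRoots, dFam_e12, cochain_two_apply, dDef_e01, dDef_e02, dDef_e12]
      simp only [Algebra.smul_def, map_add, ← hl, ← hm, ← hk]
      ext i; fin_cases i <;> simp [Matrix.col, Matrix.mulVec, dotProduct, Fin.sum_univ_three]
      · rw [hn]; linear_combination (-m) * h2)
  refine ⟨g, fun x => ?_, hd⟩
  rw [hg]
  simp only [Algebra.smul_def, map_sub, ← hl, ← hm, ← hk]
  ext i; fin_cases i <;> simp [Matrix.mulVec, dotProduct, Fin.sum_univ_three, hn]
  ring

end Brackets

/-! ### The normal form over a local base -/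

section NormalForm

variable {B : Type u} [CommRing B] [Algebra ℂ B]

/-- The kernel of an augmentation of a local algebra is the maximal ideal. -/
theorem isUnit_of_aug_ne_zero [IsLocalRing B] (ε : B →ₐ[ℂ] ℂ) {x : B} (hx : ε x ≠ 0) :
    IsUnit x := by
  set y := algebraMap ℂ B (ε x)⁻¹ * x with hy
  have hεy : ε y = 1 := by rw [hy, map_mul, AlgHom.commutes]; exact inv_mul_cancel₀ hx
  rcases IsLocalRing.isUnit_or_isUnit_one_sub_self y with h | h
  · exact isUnit_of_mul_isUnit_right h
  · exact absurd (h.map ε) (by simp [hεy])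

theorem isUnit_algebraMap {c : ℂ} (hc : c ≠ 0) : IsUnit (algebraMap ℂ B c) :=
  (IsUnit.mk0 c hc).map (algebraMap ℂ B)

/-- The Jacobi identity in terms of the structure constants. -/
theorem IsCodifferential.jacobi {d : Cochain B 2} (hd : IsCodifferential d) :
    (d ![e B 0, e B 1] 0 - d ![e B 1, e B 2] 2) • d ![e B 0, e B 2] +
      (d ![e B 0, e B 1] 1 + d ![e B 0, e B 2] 2) • d ![e B 1, e B 2] -
      (d ![e B 0, e B 2] 0 + d ![e B 1, e B 2] 1) • d ![e B 0, e B 1] = 0 := by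
  have h := hd (e B 0) (e B 1) (e B 2)
  have hdet : (Matrix.of ![e B 0, e B 1, e B 2]).det = 1 := by
    rw [Matrix.det_fin_three]; simp
  rw [bracket₂₂, comp₂₂_eq, hdet, one_smul, ← two_smul ℂ] at h
  exact (smul_eq_zero_iff_right (two_ne_zero (α := ℂ))).1 h

/-- Over a local base the deformations have a normal form. With `θ` the trace form
`x ↦ tr (ad x)`, the kernel of `θ` is free of rank two and contains all brackets; the Jacobi
identity makes it abelian, and `ad` of a complement acts on it with the cyclic vector `f₂`. -/
theorem IsDeformation.exists_infEquivalent_dDef [IsLocalRing B] {lam mu : ℂ} (h : lam + mu ≠ 0)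
    {ε : B →ₐ[ℂ] ℂ} {dB : Cochain B 2} (hd : IsDeformation (dFam lam mu) ε dB) :
    ∃ b : B, ε b = 0 ∧ InfEquivalent ε (dDef lam mu b) dB := by
  have hJ := hd.isCodifferential.jacobi
  have hp := pushforward_two_e (ε : B →+* ℂ) dB (show (0 : Fin 3) < 1 by decide)
  have hq := pushforward_two_e (ε : B →+* ℂ) dB (show (0 : Fin 3) < 2 by decide)
  have hr := pushforward_two_e (ε : B →+* ℂ) dB (show (1 : Fin 3) < 2 by decide)
  rw [hd.augmentation] at hp hq hr
  rw [dFam_e01] at hp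
  rw [dFam_e02] at hq
  rw [dFam_e12] at hr
  have hval := cochain_two_apply dB
  generalize dB ![e B 0, e B 1] = p at *
  generalize dB ![e B 0, e B 2] = q at *
  generalize dB ![e B 1, e B 2] = r at *
  have hp0 : ε (p 0) = 0 := by simpa using (congrFun hp 0).symm
  have hp1 : ε (p 1) = 0 := by simpa using (congrFun hp 1).symm
  have hq0 : ε (q 0) = lam := by simpa using (congrFun hq 0).symm
  have hq1 : ε (q 1) = 0 := by simpa using (congrFun hq 1).symm
  have hq2 : ε (q 2) = 0 := by simpa using (congrFun hq 2).symm
  have hr0 : ε (r 0) = 1 := by simpa using (congrFun hr 0).symm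
  have hr1 : ε (r 1) = mu := by simpa using (congrFun hr 1).symm
  have hr2 : ε (r 2) = 0 := by simpa using (congrFun hr 2).symm
  have hJ' : ∀ i, (p 0 - r 2) * q i + (p 1 + q 2) * r i - (q 0 + r 1) * p i = 0 := fun i => by
    simpa using congrFun hJ i
  obtain ⟨k, hk⟩ := (isUnit_of_aug_ne_zero ε (x := q 0 + r 1)
    (by rw [map_add, hq0, hr1]; exact h)).exists_right_inv
  have hεk : (lam + mu) * ε k = 1 := by
    simpa [hq0, hr1] using congrArg ε hk
  set l := algebraMap ℂ B lam with hl
  set m := algebraMap ℂ B mu with hm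
  -- `w f₃` has trace `-(lam + mu)`, and `f₁ - a₁ f₃`, `f₂ - a₂ f₃` span the kernel of `θ`
  set w := (l + m) * k with hw
  set a₁ := -(k * (p 1 + q 2)) with ha₁
  set a₂ := -(k * (r 2 - p 0)) with ha₂
  have hw' : w * (q 0 + r 1) = l + m := by rw [hw]; linear_combination (l + m) * hk
  have hεw : ε w = 1 := by
    rw [hw, map_mul, map_add, hl, hm, AlgHom.commutes, AlgHom.commutes]; exact hεk
  have hεm : ε m = mu := by rw [hm, AlgHom.commutes]; rfl
  have hεl : ε l = lam := by rw [hl, AlgHom.commutes]; rfl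
  have hεa₂ : ε a₂ = 0 := by simp [ha₂, hr2, hp0]
  -- brackets lie in the kernel of `θ`
  have hq' : q 2 = -(a₁ * q 0) - a₂ * q 1 := by
    rw [ha₁, ha₂]; linear_combination k * hJ' 1 - q 2 * hk
  have hr' : r 2 = -(a₁ * r 0) - a₂ * r 1 := by
    rw [ha₁, ha₂]; linear_combination -k * hJ' 0 - r 2 * hk
  -- the kernel of `θ` is abelian
  have hp' : ∀ i, p i - a₂ * q i + a₁ * r i = 0 := fun i => by
    rw [ha₁, ha₂]; linear_combination -k * hJ' i - p i * hk
  refine ⟨w * r 0 * (w * q 1) + (w * r 1 - m) * (w * r 1) - l * (w * r 1 - m), ?_, ?_⟩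
  · simp [hεw, hr0, hq1, hr1, hεm]
  · refine (infEquivalent_of_matrix
      !![w * r 0, 0, 0; w * r 1 - m, 1, 0; w * r 2 + m * a₂, -a₂, w] ?_ ?_ ?_ ?_ ?_).symm
    · refine isUnit_of_aug_ne_zero ε ?_
      rw [Matrix.det_fin_three]
      simp [hεw, hr0]
    · intro i j
      fin_cases i <;> fin_cases j <;> simp [hεw, hr0, hr1, hr2, hεm, hεa₂]
    · rw [hval, dDef_e01]
      ext i
      simp [Matrix.col]
      linear_combination w * r 0 * hp' i - r i * w * hr'
    · rw [hval, dDef_e02, ← hl]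
      ext i; fin_cases i <;> simp [Matrix.col, Matrix.mulVec, dotProduct, Fin.sum_univ_three]
      · linear_combination w * r 0 * hw'
      · ring
      · linear_combination w ^ 2 * r 0 * hq' + ((w * r 1 - m) * w - w * l) * hr' -
          a₁ * w * r 0 * hw'
    · rw [hval, dDef_e12, ← hm]
      ext i; fin_cases i <;> simp [Matrix.col, Matrix.mulVec, dotProduct, Fin.sum_univ_three]
      ring

end NormalForm

/-! ### The Killing form and the parameter -/

section Invariant

variable {A : Type u} [CommRing A] {B : Type v} [CommRing B]

/-- The trace form `x ↦ tr (ad x)`. -/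
noncomputable def adTrace (d : Cochain A 2) (x : Fin 3 → A) : A :=
  LinearMap.trace A _ (bilin d x)

/-- The Killing quadratic form `x ↦ tr ((ad x)²)`. -/
noncomputable def killing (d : Cochain A 2) (x : Fin 3 → A) : A :=
  LinearMap.trace A _ (bilin d x ∘ₗ bilin d x)

theorem trace_eq_sum (f : (Fin 3 → A) →ₗ[A] (Fin 3 → A)) :
    LinearMap.trace A _ f = f (e A 0) 0 + f (e A 1) 1 + f (e A 2) 2 := by
  rw [LinearMap.trace_eq_matrix_trace A (Pi.basisFun A (Fin 3)), Matrix.trace]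
  simp [Fin.sum_univ_three]

theorem adTrace_eq (d : Cochain A 2) (x : Fin 3 → A) : adTrace d x =
    d ![x, e A 0] 0 + d ![x, e A 1] 1 + d ![x, e A 2] 2 := trace_eq_sum _

theorem killing_eq (d : Cochain A 2) (x : Fin 3 → A) : killing d x =
    d ![x, d ![x, e A 0]] 0 + d ![x, d ![x, e A 1]] 1 + d ![x, d ![x, e A 2]] 2 := trace_eq_sum _

theorem bilin_of_pullback_eq {g : (Fin 3 → A) ≃ₗ[A] (Fin 3 → A)} {d d' : Cochain A 2}
    (h : pullback g d = d') (x : Fin 3 → A) : bilin d (g x) = g.conj (bilin d' x) := by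
  rw [pullback_eq_iff] at h
  refine LinearMap.ext fun y => ?_
  rw [LinearEquiv.conj_apply_apply, bilin_apply, bilin_apply, ← h, g.apply_symm_apply]

theorem adTrace_of_pullback_eq {g : (Fin 3 → A) ≃ₗ[A] (Fin 3 → A)} {d d' : Cochain A 2}
    (h : pullback g d = d') (x : Fin 3 → A) : adTrace d (g x) = adTrace d' x := by
  rw [adTrace, bilin_of_pullback_eq h, LinearMap.trace_conj']; rfl

theorem killing_of_pullback_eq {g : (Fin 3 → A) ≃ₗ[A] (Fin 3 → A)} {d d' : Cochain A 2}
    (h : pullback g d = d') (x : Fin 3 → A) : killing d (g x) = killing d' x := by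
  rw [killing, bilin_of_pullback_eq h, ← LinearEquiv.conj_comp, LinearMap.trace_conj']; rfl

theorem adTrace_pushforward (f : A →+* B) (d : Cochain A 2) (x : Fin 3 → A) :
    adTrace (pushforward f d) (f ∘ x) = f (adTrace d x) := by
  simp only [adTrace_eq, ← comp_e f, pushforward_two_comp, Function.comp_apply, map_add]

theorem killing_pushforward (f : A →+* B) (d : Cochain A 2) (x : Fin 3 → A) :
    killing (pushforward f d) (f ∘ x) = f (killing d x) := by
  simp only [killing_eq, ← comp_e f, pushforward_two_comp, Function.comp_apply, map_add]

theorem bilin_dFam_add_psi132 (l m t : A) (x y : Fin 3 → A) :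
    (dFam l m + t • psi132 A) ![x, y] =
      ![l * (x 0 * y 2 - x 2 * y 0) + (x 1 * y 2 - x 2 * y 1),
        t * (x 0 * y 2 - x 2 * y 0) + m * (x 1 * y 2 - x 2 * y 1), 0] := by
  rw [cochain_two_apply]
  simp only [AlternatingMap.add_apply, AlternatingMap.smul_apply, dFam_e01, dFam_e02, dFam_e12,
    psi132_e01, psi132_e02, psi132_e12]
  ext i; fin_cases i <;> simp <;> ring

theorem adTrace_dFam_add_psi132 (l m t : A) (x : Fin 3 → A) :
    adTrace (dFam l m + t • psi132 A) x = -(l + m) * x 2 := by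
  simp only [adTrace_eq, bilin_dFam_add_psi132]
  simp
  ring

theorem killing_dFam_add_psi132 (l m t : A) (x : Fin 3 → A) :
    killing (dFam l m + t • psi132 A) x = (l ^ 2 + m ^ 2 + 2 * t) * x 2 ^ 2 := by
  simp only [killing_eq, bilin_dFam_add_psi132]
  simp
  ring

/-- The Killing form is a multiple of the square of the trace form; the factor is
`(l² + m² + 2t) / (l + m)²`, which determines `t`. -/
theorem killing_mul_of_equivalent {l m t : A} {d : Cochain A 2}
    (h : Equivalent (dFam l m + t • psi132 A) d) (x : Fin 3 → A) :
    (l + m) ^ 2 * killing d x = (l ^ 2 + m ^ 2 + 2 * t) * adTrace d x ^ 2 := by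
  obtain ⟨g, hg⟩ := h
  rw [← killing_of_pullback_eq hg, ← adTrace_of_pullback_eq hg, killing_dFam_add_psi132,
    adTrace_dFam_add_psi132]
  ring

theorem parameter_eq_of_equivalent [Algebra ℂ A] {lam mu : ℂ} (h : lam + mu ≠ 0) {t t' : A}
    (ht : Equivalent (dDef lam mu t) (dDef lam mu t')) : t = t' := by
  have hk := killing_mul_of_equivalent ht (e A 2)
  rw [dDef, killing_dFam_add_psi132, adTrace_dFam_add_psi132] at hk
  have hu : IsUnit (algebraMap ℂ A (2 * (lam + mu) ^ 2)) :=
    isUnit_algebraMap (mul_ne_zero two_ne_zero (pow_ne_zero 2 h))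
  refine (hu.mul_left_cancel ?_).symm
  simp only [map_mul, map_pow, map_add, map_ofNat]
  simp at hk
  linear_combination hk

end Invariant

/-! ### Cohomology -/

section Cohomology

variable {lam mu : ℂ}

theorem cochain_three_apply (θ : Cochain ℂ 3) (a b c : Fin 3 → ℂ) :
    θ ![a, b, c] = (Matrix.of ![a, b, c]).det • θ ![e ℂ 0, e ℂ 1, e ℂ 2] := by
  ext i
  have h := AlternatingMap.eq_smul_basis_det (Pi.basisFun ℂ (Fin 3))
    ((LinearMap.proj i : (Fin 3 → ℂ) →ₗ[ℂ] ℂ).compAlternatingMap θ)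
  have h' := DFunLike.congr_fun h ![a, b, c]
  have hb : (fun i => Pi.basisFun ℂ (Fin 3) i) = ![e ℂ 0, e ℂ 1, e ℂ 2] := by
    ext i : 1; fin_cases i <;> simp
  rw [Pi.basisFun_det, AlternatingMap.smul_apply] at h'
  simp only [LinearMap.compAlternatingMap_apply, LinearMap.proj_apply, smul_eq_mul] at h'
  rw [h', Pi.smul_apply, smul_eq_mul, mul_comm, ← hb]
  rfl

theorem h3Vanishes_dFam (h : lam + mu ≠ 0) : H3Vanishes (dFam lam mu) := by
  intro θ
  -- `[d, η]` is linear in the structure constants of `η`; dividing only by `lam + mu` avoids a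
  -- case distinction on which of `lam`, `mu` vanishes
  set v := θ ![e ℂ 0, e ℂ 1, e ℂ 2] with hv
  obtain ⟨η, h01, h02, h12⟩ := exists_cochain_two
    ![-(v 0 / (lam + mu)), -(v 1 / (lam + mu)), -(v 2 / (lam + mu))]
    ![0, 0, v 1 / (lam + mu)] ![0, 0, -(v 0 / (lam + mu))]
  refine ⟨η, fun a b c => ?_⟩
  rw [cochain_three_apply, bracket₂₂, comp₂₂_eq, comp₂₂_eq, dFam_e01, dFam_e02, dFam_e12, h01, h02,
    h12, ← smul_add]
  congr 1
  ext i; fin_cases i <;> simp [← hv] <;> field_simp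

/-- `L₃` has rank three, so the cocycle condition amounts to three linear equations. -/
theorem isCocycle₂_dFam_iff (η : Cochain ℂ 2) : IsCocycle₂ (dFam lam mu) η ↔
    η ![e ℂ 0, e ℂ 1] 1 + η ![e ℂ 0, e ℂ 2] 2 =
        mu * η ![e ℂ 0, e ℂ 1] 0 + lam * η ![e ℂ 1, e ℂ 2] 2 ∧
      lam * η ![e ℂ 0, e ℂ 1] 1 = mu * η ![e ℂ 0, e ℂ 2] 2 ∧
      (lam + mu) * η ![e ℂ 0, e ℂ 1] 2 = 0 := by
  have key : ∀ a b c, bracket₂₂ (dFam lam mu) η a b c = (Matrix.of ![a, b, c]).det •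
      ![η ![e ℂ 0, e ℂ 1] 1 + η ![e ℂ 0, e ℂ 2] 2 -
          (mu * η ![e ℂ 0, e ℂ 1] 0 + lam * η ![e ℂ 1, e ℂ 2] 2),
        -(lam * η ![e ℂ 0, e ℂ 1] 1 - mu * η ![e ℂ 0, e ℂ 2] 2),
        -((lam + mu) * η ![e ℂ 0, e ℂ 1] 2)] := by
    intro a b c
    rw [bracket₂₂, comp₂₂_eq, comp₂₂_eq, dFam_e01, dFam_e02, dFam_e12, ← smul_add]
    congr 1
    ext i; fin_cases i <;> simp <;> ring
  constructor
  · intro hη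
    have h := hη (e ℂ 0) (e ℂ 1) (e ℂ 2)
    have hdet : (Matrix.of ![e ℂ 0, e ℂ 1, e ℂ 2]).det = 1 := by
      rw [Matrix.det_fin_three]; simp
    rw [key, hdet, one_smul] at h
    have h0 := congrFun h 0
    have h1 := congrFun h 1
    have h2 := congrFun h 2
    simp only [Matrix.cons_val_zero, Matrix.cons_val_one, Matrix.cons_val, Pi.zero_apply] at h0 h1 h2
    exact ⟨sub_eq_zero.1 h0, sub_eq_zero.1 (neg_eq_zero.1 h1), neg_eq_zero.1 h2⟩
  · rintro ⟨h0, h1, h2⟩ a b c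
    rw [key, h0, h1, h2]
    simp

/-- The endomorphism underlying a 1-cochain. -/
def endo (φ : Cochain ℂ 1) : (Fin 3 → ℂ) →ₗ[ℂ] (Fin 3 → ℂ) :=
  (AlternatingMap.ofSubsingleton ℂ (Fin 3 → ℂ) (Fin 3 → ℂ) (0 : Fin 1)).symm φ

theorem endo_apply (φ : Cochain ℂ 1) (x : Fin 3 → ℂ) : endo φ x = φ ![x] := by
  rw [Matrix.vec_single_eq_const]; rfl

theorem endo_surjective : Function.Surjective endo := fun F =>
  ⟨AlternatingMap.ofSubsingleton ℂ _ _ 0 F, Equiv.symm_apply_apply _ F⟩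

theorem bracket₂₁_eq (d : Cochain ℂ 2) (φ : Cochain ℂ 1) (a b : Fin 3 → ℂ) :
    bracket₂₁ d φ a b =
      bilin d (endo φ a) b - bilin d (endo φ b) a - endo φ (bilin d a b) := by
  simp only [endo_apply, bilin_apply, bracket₂₁]

theorem bracket₂₁_apply (d : Cochain ℂ 2) (φ : Cochain ℂ 1) (a b : Fin 3 → ℂ) :
    bracket₂₁ d φ a b =
      (a 0 * b 1 - a 1 * b 0) • bracket₂₁ d φ (e ℂ 0) (e ℂ 1) +
      (a 0 * b 2 - a 2 * b 0) • bracket₂₁ d φ (e ℂ 0) (e ℂ 2) +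
      (a 1 * b 2 - a 2 * b 1) • bracket₂₁ d φ (e ℂ 1) (e ℂ 2) := by
  simp only [bracket₂₁_eq]
  conv_lhs => rw [eq_sum_e a, eq_sum_e b]
  simp only [map_add, map_smul, map_neg, map_zero, smul_zero, LinearMap.add_apply, LinearMap.smul_apply, bilin_self,
    bilin_swap d (e ℂ 0) (e ℂ 1), bilin_swap d (e ℂ 0) (e ℂ 2), bilin_swap d (e ℂ 1) (e ℂ 2)]
  module

theorem dFam_apply (l m : ℂ) (x y : Fin 3 → ℂ) :
    dFam l m ![x, y] = ![l * (x 0 * y 2 - x 2 * y 0) + (x 1 * y 2 - x 2 * y 1),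
      m * (x 1 * y 2 - x 2 * y 1), 0] := by
  simpa using bilin_dFam_add_psi132 l m 0 x y

/-- The coboundary of an endomorphism, on the basis vectors. -/
theorem bracket₂₁_dFam (φ : Cochain ℂ 1) {a b c : Fin 3 → ℂ} (ha : endo φ (e ℂ 0) = a)
    (hb : endo φ (e ℂ 1) = b) (hc : endo φ (e ℂ 2) = c) :
    bracket₂₁ (dFam lam mu) φ (e ℂ 0) (e ℂ 1) = ![lam * b 2 - a 2, -(mu * a 2), 0] ∧
    bracket₂₁ (dFam lam mu) φ (e ℂ 0) (e ℂ 2) =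
      ![a 1 + lam * c 2, (mu - lam) * a 1, -(lam * a 2)] ∧
    bracket₂₁ (dFam lam mu) φ (e ℂ 1) (e ℂ 2) =
      ![lam * b 0 + b 1 + c 2 - a 0 - mu * b 0, mu * c 2 - a 1, -(a 2 + mu * b 2)] := by
  have h02 : (![lam, 0, 0] : Fin 3 → ℂ) = lam • e ℂ 0 := by
    ext i; fin_cases i <;> simp
  have h12 : (![1, mu, 0] : Fin 3 → ℂ) = e ℂ 0 + mu • e ℂ 1 := by
    ext i; fin_cases i <;> simp
  simp only [bracket₂₁_eq, ha, hb, hc, bilin_apply]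
  rw [dFam_e01, dFam_e02, dFam_e12, h02, h12]
  simp only [map_add, map_smul, map_zero, ha, hb, dFam_apply]
  refine ⟨?_, ?_, ?_⟩ <;>
  · ext i; fin_cases i <;> simp <;> ring

/-- Among the cocycles the coboundaries are cut out by one further linear equation, which fails
for `ψ^{13}_2`. The endomorphism in the proof solves the equations of `bracket₂₁_dFam`. -/
theorem isCoboundary₂_dFam_of (h : lam + mu ≠ 0) {η : Cochain ℂ 2}
    (hη : IsCocycle₂ (dFam lam mu) η)
    (hψ : (lam + mu) * η ![e ℂ 0, e ℂ 2] 1 =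
      (mu - lam) * (mu * η ![e ℂ 0, e ℂ 2] 0 - lam * η ![e ℂ 1, e ℂ 2] 1)) :
    IsCoboundary₂ (dFam lam mu) η := by
  rw [isCocycle₂_dFam_iff] at hη
  have hval := cochain_two_apply η
  generalize η ![e ℂ 0, e ℂ 1] = p at *
  generalize η ![e ℂ 0, e ℂ 2] = q at *
  generalize η ![e ℂ 1, e ℂ 2] = r at *
  obtain ⟨h0, h1, h2⟩ := hη
  obtain ⟨k, hk⟩ : ∃ k, (lam + mu) * k = 1 := ⟨_, mul_inv_cancel₀ h⟩
  have h2' : p 2 = 0 := (mul_eq_zero.1 h2).resolve_left h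
  obtain ⟨φ, hφ⟩ := endo_surjective (Matrix.toLin'
    !![(q 0 + r 1) * k - r 0, 0, 0;
      q 0 - lam * ((q 0 + r 1) * k), 0, 0;
      -((p 1 + q 2) * k), (p 0 - r 2) * k, (q 0 + r 1) * k])
  obtain ⟨e01, e02, e12⟩ := bracket₂₁_dFam (lam := lam) (mu := mu) φ rfl rfl rfl
  refine ⟨φ, fun a b => ?_⟩
  rw [hval, bracket₂₁_apply, e01, e02, e12, hφ]
  congr 1
  · congr 1
    · congr 1
      ext i; fin_cases i <;> simp
      · linear_combination -k * h0 - p 0 * hk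
      · linear_combination k * h1 - p 1 * hk
      · exact h2'
    · congr 1
      ext i; fin_cases i <;> simp
      · linear_combination k * hψ - q 1 * hk + (mu - lam) * q 0 * hk
      · linear_combination -k * h1 - q 2 * hk
  · congr 1
    ext i; fin_cases i <;> simp
    · linear_combination -(q 0 + r 1) * hk
    · linear_combination -k * h0 - r 2 * hk

theorem isPrebasisH2_dFam (h : lam + mu ≠ 0) : IsPrebasisH2 (dFam lam mu) (psi132 ℂ) := by
  have hψ : IsCocycle₂ (dFam lam mu) (psi132 ℂ) := by
    rw [isCocycle₂_dFam_iff, psi132_e01, psi132_e02, psi132_e12]; simp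
  refine ⟨hψ, ?_, fun η hη => ?_⟩
  · rintro ⟨φ, hφ⟩
    obtain ⟨-, e02, e12⟩ := bracket₂₁_dFam (lam := lam) (mu := mu) φ rfl rfl rfl
    rw [← hφ, psi132_e02] at e02
    rw [← hφ, psi132_e12] at e12
    have h0 := congrFun e02 0
    have h1 := congrFun e02 1
    have h2 := congrFun e12 1
    simp at h0 h1 h2
    apply h
    linear_combination (lam + mu) * h1 + (mu - lam) * (lam * h2 - mu * h0)
  · refine ⟨η ![e ℂ 0, e ℂ 2] 1 - (mu - lam) * (mu * η ![e ℂ 0, e ℂ 2] 0 -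
      lam * η ![e ℂ 1, e ℂ 2] 1) / (lam + mu), isCoboundary₂_dFam_of h ?_ ?_⟩
    · rw [isCocycle₂_dFam_iff] at hη ⊢
      simpa [psi132_e01, psi132_e02, psi132_e12] using hη
    · simp [psi132_e02, psi132_e12]
      field_simp

end Cohomology

/-! ### Formal algebras -/

section Algebras

variable {B : Type u} [CommRing B] [Algebra ℂ B]

theorem isLocalRing_of_aug (ε : B →ₐ[ℂ] ℂ) (h : ∀ x, ε x ≠ 0 → IsUnit x) : IsLocalRing B := by
  have : Nontrivial B := ε.toRingHom.domain_nontrivial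
  refine IsLocalRing.of_isUnit_or_isUnit_one_sub_self fun x => ?_
  by_cases hx : ε x = 0
  · exact Or.inr (h _ (by simp [hx]))
  · exact Or.inl (h _ hx)

theorem IsInfinitesimalAlgebra.isFormalAlgebra {ε : B →ₐ[ℂ] ℂ} (h : IsInfinitesimalAlgebra ε) :
    IsFormalAlgebra ε := by
  have hsq := h.sq_eq_bot
  refine ⟨h.isLocalRing, { haus' := fun x hx => ?_, prec' := fun f hf => ⟨f 2, fun n => ?_⟩ }⟩
  · simpa [hsq, SModEq.zero] using hx 2
  · rcases le_total n 2 with hn | hn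
    · exact hf hn
    · have h2 : f 2 = f n := by simpa [hsq, SModEq.bot] using hf hn
      rw [h2]

theorem isFormalAlgebra_powerSeries : IsFormalAlgebra powerSeriesAug := by
  refine ⟨inferInstance, ?_⟩
  have hker : RingHom.ker powerSeriesAug = Ideal.span {(PowerSeries.X : ℂ⟦X⟧)} := by
    ext f
    rw [RingHom.mem_ker, Ideal.mem_span_singleton, PowerSeries.X_dvd_iff]
    rfl
  rw [hker]
  infer_instance

theorem isInfinitesimalAlgebra_dualNumber : IsInfinitesimalAlgebra dualNumberAug := by
  refine ⟨inferInstance, ?_⟩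
  rw [pow_two, eq_bot_iff, Ideal.mul_le]
  intro x hx y hy
  have hx : x.fst = 0 := hx
  have hy : y.fst = 0 := hy
  rw [Ideal.mem_bot]
  ext <;> simp [hx, hy]

/-- Power series can be evaluated at the elements of the maximal ideal of a formal algebra. -/
theorem exists_algHom_powerSeries {ε : B →ₐ[ℂ] ℂ} (h : IsFormalAlgebra ε) {b : B}
    (hb : ε b = 0) : ∃ f : ℂ⟦X⟧ →ₐ[ℂ] B, f PowerSeries.X = b := by
  let : UniformSpace ℂ := ⊥
  have : DiscreteTopology ℂ := ⟨rfl⟩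
  let : WithIdeal B := ⟨RingHom.ker ε⟩
  obtain ⟨_, _⟩ := (IsAdic.isAdicComplete_iff (I := RingHom.ker ε) (R := B) rfl).1 h.complete
  have hb' : PowerSeries.HasEval b := WithIdeal.isTopologicallyNilpotent_of_mem (RingHom.mem_ker.2 hb)
  have : ContinuousSMul ℂ B := DiscreteTopology.instContinuousSMul ℂ B
  refine ⟨PowerSeries.aeval hb', ?_⟩
  rw [← Polynomial.coe_X, PowerSeries.aeval_coe, Polynomial.aeval_X]

/-- A homomorphism from `ℂ[[t]]` is local: `t - c` is a unit for `c ≠ 0`. -/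
theorem aug_algHom_X (ε : B →ₐ[ℂ] ℂ) (f : ℂ⟦X⟧ →ₐ[ℂ] B) : ε (f PowerSeries.X) = 0 := by
  by_contra hc
  have hu : IsUnit (PowerSeries.X - PowerSeries.C (ε (f PowerSeries.X)) : ℂ⟦X⟧) := by
    rw [PowerSeries.isUnit_iff_constantCoeff]
    simpa using hc
  have h0 := hu.map (ε.comp f)
  have hC : f (PowerSeries.C (ε (f PowerSeries.X))) = algebraMap ℂ B (ε (f PowerSeries.X)) :=
    f.commutes _
  simp [hC] at h0

theorem algHom_powerSeries_ext {ε : B →ₐ[ℂ] ℂ} (h : IsInfinitesimalAlgebra ε)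
    {f g : ℂ⟦X⟧ →ₐ[ℂ] B} (hfg : f PowerSeries.X = g PowerSeries.X) : f = g := by
  have hsq : ∀ f : ℂ⟦X⟧ →ₐ[ℂ] B, f PowerSeries.X * f PowerSeries.X = 0 := fun f => by
    have := Ideal.mul_mem_mul (RingHom.mem_ker.2 (aug_algHom_X ε f))
      (RingHom.mem_ker.2 (aug_algHom_X ε f))
    rwa [← pow_two, h.sq_eq_bot, Ideal.mem_bot] at this
  -- as `(f X)² = 0`, only the first two coefficients of a power series matter
  have hval : ∀ (f : ℂ⟦X⟧ →ₐ[ℂ] B) (p : ℂ⟦X⟧), f p =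
      f PowerSeries.X * algebraMap ℂ B (PowerSeries.coeff 1 p) +
        algebraMap ℂ B (PowerSeries.constantCoeff p) := by
    intro f p
    have hC : ∀ c, f (PowerSeries.C c) = algebraMap ℂ B c := f.commutes
    obtain ⟨q, hq⟩ : ∃ q : ℂ⟦X⟧, p = PowerSeries.X * (PowerSeries.X * q +
        PowerSeries.C (PowerSeries.coeff 1 p)) + PowerSeries.C (PowerSeries.constantCoeff p) := by
      set p' : ℂ⟦X⟧ := PowerSeries.mk fun n => PowerSeries.coeff (n + 1) p with hp'
      have hc : PowerSeries.coeff 1 p = PowerSeries.constantCoeff p' := by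
        simp [hp', ← PowerSeries.coeff_zero_eq_constantCoeff_apply]
      refine ⟨PowerSeries.mk fun n => PowerSeries.coeff (n + 1) p', ?_⟩
      rw [hc, ← PowerSeries.eq_X_mul_shift_add_const p', hp',
        ← PowerSeries.eq_X_mul_shift_add_const p]
    conv_lhs => rw [hq]
    simp only [map_add, map_mul, hC]
    linear_combination f q * hsq f
  ext p
  rw [hval f, hval g, hfg]

end Algebras

/-! ### Adjoining a square root -/

section QuadraticExtension

variable {B : Type u} [CommRing B] [Algebra ℂ B]

/-- The augmentation of `B[ω]/(ω² - c)` that sends `ω` to `0`, for `c` in the augmentation ideal. -/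
def quadraticAug (ε : B →ₐ[ℂ] ℂ) {c : B} (hc : ε c = 0) : QuadraticAlgebra B c 0 →ₐ[ℂ] ℂ where
  toFun x := ε x.re
  map_one' := map_one ε
  map_zero' := by simp
  map_add' := by simp
  map_mul' := by simp [hc]
  commutes' r := by
    rw [IsScalarTower.algebraMap_apply ℂ B (QuadraticAlgebra B c 0)]
    simp

/-- `B[ω]/(ω² - c)` is formal if `B` is: the square of its augmentation ideal lies in `𝔪[ω]`, so
that its adic topology is the product topology of `B × B`. -/
theorem isFormalAlgebra_quadratic {ε : B →ₐ[ℂ] ℂ} (h : IsFormalAlgebra ε) {c : B} (hc : ε c = 0) :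
    IsFormalAlgebra (quadraticAug ε hc) := by
  have := h.isLocalRing
  have := h.complete
  set 𝔪 := RingHom.ker ε with h𝔪
  set 𝔫 := RingHom.ker (quadraticAug ε hc) with h𝔫
  have hmul : ∀ (I J : Ideal B) (x y : QuadraticAlgebra B c 0), x.re ∈ I → x.im ∈ I → y.re ∈ J →
      y.im ∈ J → (x * y).re ∈ I * J ∧ (x * y).im ∈ I * J := by
    intro I J x y hx hx' hy hy'
    simp only [QuadraticAlgebra.re_mul, QuadraticAlgebra.im_mul, zero_mul, add_zero]
    refine ⟨add_mem (Ideal.mul_mem_mul hx hy) ?_,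
      add_mem (Ideal.mul_mem_mul hx hy') (Ideal.mul_mem_mul hx' hy)⟩
    rw [mul_assoc]
    exact Ideal.mul_mem_left _ _ (Ideal.mul_mem_mul hx' hy')
  -- the coordinates of an element of `𝔫²ⁿ` lie in `𝔪ⁿ`
  have hcoord : ∀ n, ∀ x ∈ 𝔫 ^ (2 * n), x.re ∈ 𝔪 ^ n ∧ x.im ∈ 𝔪 ^ n := by
    have hsq : ∀ x ∈ 𝔫 ^ 2, x.re ∈ 𝔪 ∧ x.im ∈ 𝔪 := by
      intro x hx
      rw [pow_two] at hx
      induction hx using Submodule.mul_induction_on' with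
      | mem_mul_mem x hx y hy =>
        have hx : x.re ∈ 𝔪 := hx
        have hy : y.re ∈ 𝔪 := hy
        have hc' : c ∈ 𝔪 := hc
        simp only [QuadraticAlgebra.re_mul, QuadraticAlgebra.im_mul, zero_mul, add_zero]
        exact ⟨add_mem (Ideal.mul_mem_right _ _ hx)
          (Ideal.mul_mem_right _ _ (Ideal.mul_mem_right _ _ hc')),
          add_mem (Ideal.mul_mem_right _ _ hx) (Ideal.mul_mem_left _ _ hy)⟩
      | add x _ y _ hx hy => exact ⟨add_mem hx.1 hy.1, add_mem hx.2 hy.2⟩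
    intro n
    induction n with
    | zero => intro x _; simp
    | succ n ih =>
      intro x hx
      rw [mul_add, mul_one, pow_add] at hx
      rw [pow_succ]
      induction hx using Submodule.mul_induction_on' with
      | mem_mul_mem x hx y hy =>
        exact hmul _ _ x y (ih x hx).1 (ih x hx).2 (hsq y hy).1 (hsq y hy).2
      | add x _ y _ hx hy => exact ⟨add_mem hx.1 hy.1, add_mem hx.2 hy.2⟩
  have hmap : ∀ n, ∀ x : QuadraticAlgebra B c 0, x.re ∈ 𝔪 ^ n → x.im ∈ 𝔪 ^ n → x ∈ 𝔫 ^ n := by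
    intro n x hre him
    have hle : (𝔪 ^ n).map (algebraMap B (QuadraticAlgebra B c 0)) ≤ 𝔫 ^ n := by
      rw [Ideal.map_pow]
      refine Ideal.pow_right_mono (Ideal.map_le_iff_le_comap.2 fun y hy => ?_) n
      exact hy
    have hx : x = algebraMap B _ x.re + algebraMap B _ x.im * ⟨0, 1⟩ := by
      ext <;> simp
    rw [hx]
    exact add_mem (hle (Ideal.mem_map_of_mem _ hre))
      (Ideal.mul_mem_right _ _ (hle (Ideal.mem_map_of_mem _ him)))
  refine ⟨isLocalRing_of_aug (quadraticAug ε hc) fun x hx => ?_, ?_⟩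
  · have hx : ε x.re ≠ 0 := hx
    have hu : IsUnit (x.re ^ 2 - c * x.im ^ 2) :=
      isUnit_of_aug_ne_zero ε (by simpa [hc] using hx)
    have hprod : x * ⟨x.re, -x.im⟩ = algebraMap B _ (x.re ^ 2 - c * x.im ^ 2) := by
      rw [QuadraticAlgebra.algebraMap_eq]
      ext
      · simp; ring
      · simp; ring
    exact isUnit_of_mul_isUnit_left (hprod ▸ hu.map (algebraMap B (QuadraticAlgebra B c 0)))
  · refine { haus' := fun x hx => ?_, prec' := fun f hf => ?_ }
    · have hx' : ∀ n, x.re ∈ 𝔪 ^ n ∧ x.im ∈ 𝔪 ^ n := fun n => hcoord n x (by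
        simpa [SModEq.zero] using hx (2 * n))
      ext
      · exact IsHausdorff.haus' (I := 𝔪) _ fun n => by simpa [SModEq.zero] using (hx' n).1
      · exact IsHausdorff.haus' (I := 𝔪) _ fun n => by simpa [SModEq.zero] using (hx' n).2
    · have hf' : ∀ {m n}, m ≤ n → f m - f n ∈ 𝔫 ^ m := fun {m n} hmn => by
        simpa [SModEq.sub_mem] using hf hmn
      have hdiff : ∀ {m n}, m ≤ n → (f (2 * m)).re - (f (2 * n)).re ∈ 𝔪 ^ m ∧
          (f (2 * m)).im - (f (2 * n)).im ∈ 𝔪 ^ m := fun {m n} hmn => by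
        simpa using hcoord m _ (hf' (Nat.mul_le_mul_left 2 hmn))
      obtain ⟨L, hL⟩ := IsPrecomplete.prec' (I := 𝔪) (fun n => (f (2 * n)).re)
        fun {m n} hmn => by simpa [SModEq.sub_mem] using (hdiff hmn).1
      obtain ⟨L', hL'⟩ := IsPrecomplete.prec' (I := 𝔪) (fun n => (f (2 * n)).im)
        fun {m n} hmn => by simpa [SModEq.sub_mem] using (hdiff hmn).2
      refine ⟨⟨L, L'⟩, fun n => ?_⟩
      have h1 : f (2 * n) - ⟨L, L'⟩ ∈ 𝔫 ^ n := by
        apply hmap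
        · simpa [SModEq.sub_mem] using hL n
        · simpa [SModEq.sub_mem] using hL' n
      have h2 := add_mem (hf' (show n ≤ 2 * n by omega)) h1
      rw [sub_add_sub_cancel] at h2
      simpa [SModEq.sub_mem] using h2

/-- A square root of `δ² + 4b` exists in a formal extension of `B`: by Hensel's lemma in
`B` itself if `δ ≠ 0`, and by adjunction if `δ = 0`. -/
theorem exists_formal_sqrt {ε : B →ₐ[ℂ] ℂ} (h : IsFormalAlgebra ε) (δ : ℂ) {b : B}
    (hb : ε b = 0) :
    ∃ (C : Type u) (_ : CommRing C) (_ : Algebra ℂ C) (εC : C →ₐ[ℂ] ℂ) (j : B →ₐ[ℂ] C) (s : C),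
      IsFormalAlgebra εC ∧ Function.Injective j ∧ (∀ x, εC (j x) = ε x) ∧
      s ^ 2 = algebraMap ℂ C (δ ^ 2) + 4 * j b ∧ εC s = δ := by
  by_cases hδ : δ = 0
  · have h4 : ε (4 * b) = 0 := by simp [hb]
    refine ⟨QuadraticAlgebra B (4 * b) 0, inferInstance, inferInstance, quadraticAug ε h4,
      Algebra.algHom ℂ B _, ⟨0, 1⟩, isFormalAlgebra_quadratic h h4,
      QuadraticAlgebra.algebraMap_injective, fun x => rfl, ?_, ?_⟩
    · subst hδ
      have h4' : (4 : QuadraticAlgebra B (4 * b) 0) = algebraMap B _ 4 :=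
        (map_ofNat (algebraMap B (QuadraticAlgebra B (4 * b) 0)) 4).symm
      change _ = _ + 4 * algebraMap B (QuadraticAlgebra B (4 * b) 0) b
      rw [h4', ← map_mul, pow_two, pow_two, zero_mul, map_zero, zero_add,
        QuadraticAlgebra.algebraMap_eq]
      ext <;> simp
    · subst hδ
      exact map_zero ε
  · refine ⟨B, inferInstance, inferInstance, ε, AlgHom.id ℂ B, ?_⟩
    have := h.complete
    -- `δ` is a simple root modulo the maximal ideal, because `2δ` is a unit
    obtain ⟨s, hs, hs'⟩ := HenselianRing.is_henselian (I := RingHom.ker ε)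
      (Polynomial.X ^ 2 - Polynomial.C (algebraMap ℂ B (δ ^ 2) + 4 * b))
      (Polynomial.monic_X_pow_sub_C _ two_ne_zero) (algebraMap ℂ B δ)
      (by simp [RingHom.mem_ker, hb])
      (by
        have h2 : (2 : B) * algebraMap ℂ B δ = algebraMap ℂ B (2 * δ) := by
          rw [map_mul, map_ofNat]
        rw [Polynomial.derivative_sub, Polynomial.derivative_C, Polynomial.derivative_X_pow]
        have hu := (isUnit_algebraMap (B := B) (mul_ne_zero two_ne_zero hδ)).map
          (Ideal.Quotient.mk (RingHom.ker ε))
        rw [← h2] at hu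
        simpa only [Polynomial.eval_sub, Polynomial.eval_mul, Polynomial.eval_C, Polynomial.eval_X,
          Polynomial.eval_zero, sub_zero, Nat.cast_ofNat, pow_one, Nat.add_one_sub_one] using hu)
    refine ⟨s, h, Function.injective_id, fun _ => rfl, ?_, ?_⟩
    · simpa [Polynomial.IsRoot, sub_eq_zero] using hs
    · simpa [RingHom.mem_ker, sub_eq_zero] using hs'

end QuadraticExtension

/-! ### Descent of equivalences to the complex numbers -/

section Descent

/-- The weak Nullstellensatz. -/
theorem nonempty_algHom_of_finiteType (R : Type*) [CommRing R] [Nontrivial R] [Algebra ℂ R]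
    [Algebra.FiniteType ℂ R] : Nonempty (R →ₐ[ℂ] ℂ) := by
  obtain ⟨M, hM⟩ := Ideal.exists_maximal R
  let := Ideal.Quotient.field M
  have : Module.Finite ℂ (R ⧸ M) := finite_of_finite_type_of_isJacobsonRing ℂ (R ⧸ M)
  have hbij : Function.Bijective (algebraMap ℂ (R ⧸ M)) :=
    IsAlgClosed.algebraMap_bijective_of_isIntegral
  exact ⟨((AlgEquiv.ofBijective (Algebra.ofId ℂ (R ⧸ M)) hbij).symm :
    (R ⧸ M) →ₐ[ℂ] ℂ).comp (Ideal.Quotient.mkₐ ℂ M)⟩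

/-- Over an algebraically closed base field, an equivalence of complex structures over an
extension field specializes to a complex one: it is defined over a finitely generated algebra, and
such an algebra has a complex point. -/
theorem equivalent_of_equivalent_pushforward {K : Type*} [Field K] (γ : ℂ →+* K)
    {d d' : Cochain ℂ 2} (h : Equivalent (pushforward γ d) (pushforward γ d')) :
    Equivalent d d' := by
  let : Algebra ℂ K := γ.toAlgebra
  obtain ⟨g, hg⟩ := h
  set P := LinearMap.toMatrix' (g : (Fin 3 → K) →ₗ[K] (Fin 3 → K)) with hPdef
  have hP : ∀ x, P.mulVec x = g x := fun x => by
    rw [hPdef, LinearMap.toMatrix'_mulVec]; rfl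
  have hcolP : ∀ i, P.col i = g (e K i) := fun i => by rw [← hP, Matrix.mulVec_single_one]
  have hdet : IsUnit P.det := by
    rw [hPdef, LinearMap.det_toMatrix']
    exact g.isUnit_det'
  -- the algebra `R` generated by the entries of `P` and the inverse of its determinant
  set S : Set K := Set.range (fun ij : Fin 3 × Fin 3 => P ij.1 ij.2) ∪ {P.det⁻¹} with hS
  have hSfin : S.Finite := (Set.finite_range _).union (Set.finite_singleton _)
  set R := Algebra.adjoin ℂ S with hR
  have hmem : ∀ i j, P i j ∈ R := fun i j =>
    Algebra.subset_adjoin (Or.inl ⟨(i, j), rfl⟩)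
  set Q : Matrix (Fin 3) (Fin 3) R := Matrix.of fun i j => ⟨P i j, hmem i j⟩ with hQ
  have hQP : Q.map R.val = P := by ext i j; rfl
  have hdetQ : R.val Q.det = P.det := by
    rw [← hQP]
    exact RingHom.map_det (R.val : R →+* K) Q
  have hunit : IsUnit Q.det := by
    refine IsUnit.of_mul_eq_one ⟨P.det⁻¹, Algebra.subset_adjoin (Or.inr rfl)⟩ ?_
    apply Subtype.val_injective
    change R.val Q.det * P.det⁻¹ = 1
    rw [hdetQ, mul_inv_cancel₀ hdet.ne_zero]
  have hft : Algebra.FiniteType ℂ R :=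
    (Subalgebra.fg_iff_finiteType R).1 (by
      rw [hR, ← hSfin.coe_toFinset]; exact Subalgebra.fg_adjoin_finset _)
  have hcomp : (R.val : R →+* K).comp (algebraMap ℂ R) = γ := rfl
  have hinj : Function.Injective (R.val : R →+* K) := Subtype.val_injective
  have hcol : ∀ i, (R.val : R →+* K) ∘ Q.col i = g (e K i) := fun i => hcolP i
  rw [pullback_eq_iff] at hg
  have hbr : ∀ i j : Fin 3, i < j → pushforward (algebraMap ℂ R) d ![Q.col i, Q.col j] =
      Q.mulVec (pushforward (algebraMap ℂ R) d' ![e R i, e R j]) := by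
    intro i j hij
    apply hinj.comp_left
    change (R.val : R →+* K) ∘ _ = (R.val : R →+* K) ∘ _
    have hmv : ∀ x, (R.val : R →+* K) ∘ Q.mulVec x = g ((R.val : R →+* K) ∘ x) := fun x => by
      rw [← hP]
      ext i
      exact RingHom.map_mulVec (R.val : R →+* K) Q x i
    rw [hmv, ← pushforward_two_comp, ← pushforward_two_e _ _ hij, pushforward_pushforward,
      pushforward_pushforward, hcomp, hcol, hcol, hg]
  obtain ⟨g', -, hg'⟩ := exists_pullback_eq_of_matrix Q hunit (hbr 0 1 (by decide))
    (hbr 0 2 (by decide)) (hbr 1 2 (by decide))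
  -- a complex point of `R`
  obtain ⟨ρ⟩ := nonempty_algHom_of_finiteType R
  have hfin := Equivalent.map (ρ : R →+* ℂ) ⟨g', hg'⟩
  rw [pushforward_pushforward, pushforward_pushforward] at hfin
  have hid : (ρ : R →+* ℂ).comp (algebraMap ℂ R) = RingHom.id ℂ := by
    ext x
    exact ρ.commutes x
  rwa [hid, pushforward_id, pushforward_id] at hfin

end Descent

/-! ### The deformations of the family -/

section Deformations

variable {lam mu : ℂ}

theorem isUniversalInfinitesimal_dDef (h : lam + mu ≠ 0) :
    IsUniversalInfinitesimal.{0, u} (dFam lam mu) dualNumberAug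
      (dDef lam mu (DualNumber.eps : DualNumber ℂ)) := by
  refine ⟨isInfinitesimalAlgebra_dualNumber, isDeformation_dDef lam mu _ rfl,
    fun B _ _ εB dB hB hd => ?_⟩
  have := hB.isLocalRing
  obtain ⟨b, hb, hbd⟩ := hd.exists_infEquivalent_dDef h
  have hsq : b * b = 0 := by
    have := Ideal.mul_mem_mul (RingHom.mem_ker.2 hb) (RingHom.mem_ker.2 hb)
    rwa [← pow_two, hB.sq_eq_bot, Ideal.mem_bot] at this
  refine ⟨DualNumber.lift ⟨(Algebra.ofId ℂ B, b), hsq, fun _ => Commute.all _ _⟩, ?_,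
    fun f hf => ?_⟩
  · dsimp only
    rw [pushforward_dDef, DualNumber.lift_apply_eps]
    exact hbd
  · dsimp only at hf
    rw [pushforward_dDef] at hf
    apply DualNumber.algHom_ext
    rw [DualNumber.lift_apply_eps]
    exact parameter_eq_of_equivalent h (hf.trans hbd.symm).equivalent

theorem isMiniversal_dDef (h : lam + mu ≠ 0) :
    IsMiniversal.{0, u} (dFam lam mu) powerSeriesAug
      (dDef lam mu (PowerSeries.X : PowerSeries ℂ)) := by
  have hX : powerSeriesAug PowerSeries.X = 0 := PowerSeries.constantCoeff_X
  have hversal : ∀ (B : Type u) [CommRing B] [Algebra ℂ B] (εB : B →ₐ[ℂ] ℂ) (dB : Cochain B 2),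
      IsFormalAlgebra εB → IsDeformation (dFam lam mu) εB dB → ∃ f : ℂ⟦X⟧ →ₐ[ℂ] B,
        InfEquivalent εB (pushforward (f : ℂ⟦X⟧ →+* B) (dDef lam mu PowerSeries.X)) dB := by
    intro B _ _ εB dB hB hd
    have := hB.isLocalRing
    obtain ⟨b, hb, hbd⟩ := hd.exists_infEquivalent_dDef h
    obtain ⟨f, hf⟩ := exists_algHom_powerSeries hB hb
    exact ⟨f, by rwa [pushforward_dDef, hf]⟩
  refine ⟨⟨isFormalAlgebra_powerSeries, isDeformation_dDef lam mu _ hX, hversal⟩,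
    fun B _ _ εB dB hB hd => ?_⟩
  obtain ⟨f, hf⟩ := hversal B εB dB hB.isFormalAlgebra hd
  refine ⟨f, hf, fun g hg => algHom_powerSeries_ext hB ?_⟩
  rw [pushforward_dDef] at hf hg
  exact parameter_eq_of_equivalent h (hg.trans hf.symm).equivalent

theorem equivalent_dDef_dRoots {A : Type u} [CommRing A] [Algebra ℂ A] {t s : A}
    (hs : s ^ 2 = algebraMap ℂ A ((lam - mu) ^ 2) + 4 * t) :
    Equivalent (dDef lam mu t) (dRoots lam mu s) := by
  obtain ⟨g, -, hg⟩ := exists_pullback_dDef_eq_dRoots lam mu t s hs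
  exact ⟨g, hg⟩

theorem infEquivalent_dDef_dRoots {A : Type u} [CommRing A] [Algebra ℂ A] {ε : A →ₐ[ℂ] ℂ}
    {t s : A} (hs : s ^ 2 = algebraMap ℂ A ((lam - mu) ^ 2) + 4 * t) (hε : ε s = lam - mu) :
    InfEquivalent ε (dDef lam mu t) (dRoots lam mu s) := by
  obtain ⟨g, hg, hd⟩ := exists_pullback_dDef_eq_dRoots lam mu t s hs
  refine ⟨g, fun x i => ?_, hd⟩
  rw [hg]
  simp only [Pi.add_apply, Pi.smul_apply, smul_eq_mul, map_add, map_mul, map_smul, map_sub, hε,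
    AlgHom.commutes]
  simp

theorem dRoots_complex (s : ℂ) :
    dRoots lam mu s = dFam ((lam + mu + s) / 2) ((lam + mu - s) / 2) := by
  simp only [dRoots, Algebra.algebraMap_self, RingHom.id_apply, smul_eq_mul]
  congr 1 <;> ring

theorem toGeometricGenericPoint_injective : Function.Injective toGeometricGenericPoint := by
  rw [toGeometricGenericPoint, RingHom.coe_comp]
  exact (algebraMap ℂ⸨X⸩ (AlgebraicClosure ℂ⸨X⸩)).injective.comp
    (IsFractionRing.injective ℂ⟦X⟧ ℂ⸨X⸩)

/-- The ratio of the Killing form to the square of the trace form is constant along a deformation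
that is generically equivalent to a fixed structure; hence so is the parameter. -/
theorem not_isJumpDeformation (h : lam + mu ≠ 0) (d' : Cochain ℂ 2) (dt : Cochain ℂ⟦X⟧ 2) :
    ¬ IsJumpDeformation (dFam lam mu) d' dt := by
  rintro ⟨hdef, hgen, hne⟩
  obtain ⟨b, hb, hbd⟩ := hdef.exists_infEquivalent_dDef h
  set γ := toGeometricGenericPoint with hγ
  have hinj : Function.Injective γ := toGeometricGenericPoint_injective
  set κ := γ.comp PowerSeries.C with hκ
  have hK : Equivalent (pushforward γ (dDef lam mu b)) (pushforward κ d') :=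
    (hbd.equivalent.map γ).trans hgen
  have hlam : γ (algebraMap ℂ ℂ⟦X⟧ lam) = κ lam := rfl
  have hmu : γ (algebraMap ℂ ℂ⟦X⟧ mu) = κ mu := rfl
  have hb0 : b = 0 := by
    rw [pushforward_dDef_ringHom, hlam, hmu] at hK
    have hkill : ∀ i, κ ((lam + mu) ^ 2 * killing d' (e ℂ i)) =
        (κ lam ^ 2 + κ mu ^ 2 + 2 * γ b) * κ (adTrace d' (e ℂ i)) ^ 2 := by
      intro i
      have := killing_mul_of_equivalent hK (κ ∘ e ℂ i)
      rw [killing_pushforward, adTrace_pushforward] at this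
      rw [map_mul, map_pow, map_add, this]
    -- the trace form of `d'` does not vanish, because that of the deformation does not
    obtain ⟨i, hi⟩ : ∃ i, adTrace d' (e ℂ i) ≠ 0 := by
      by_contra! hzero
      obtain ⟨g, hg⟩ := hK
      have hzero' : ∀ x, adTrace (pushforward κ d') x = 0 := by
        intro x
        have hi : ∀ i, LinearMap.trace _ _ (bilin (pushforward κ d') (e _ i)) = 0 := fun i => by
          rw [← comp_e κ]
          change adTrace (pushforward κ d') (κ ∘ e ℂ i) = 0
          rw [adTrace_pushforward, hzero, map_zero]
        rw [adTrace, eq_sum_e x]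
        simp only [map_add, map_smul, hi, smul_zero, add_zero]
      have h2 := hzero' (g.symm (e _ 2))
      rw [← adTrace_of_pullback_eq hg, g.apply_symm_apply, adTrace_dFam_add_psi132] at h2
      rw [show e (AlgebraicClosure ℂ⸨X⸩) 2 2 = 1 from Pi.single_eq_same 2 1, mul_one, neg_eq_zero,
        ← map_add] at h2
      exact h ((map_eq_zero κ).1 h2)
    -- so the parameter is a constant power series
    set c := ((lam + mu) ^ 2 * killing d' (e ℂ i) / adTrace d' (e ℂ i) ^ 2 -
      (lam ^ 2 + mu ^ 2)) / 2 with hc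
    have hci : (lam + mu) ^ 2 * killing d' (e ℂ i) =
        (lam ^ 2 + mu ^ 2 + 2 * c) * adTrace d' (e ℂ i) ^ 2 := by
      rw [hc]; field_simp; ring
    have hγb : γ b = κ c := by
      have h3 := hkill i
      rw [hci] at h3
      simp only [map_mul, map_add, map_pow, map_ofNat] at h3
      have hτ : κ (adTrace d' (e ℂ i)) ^ 2 ≠ 0 := pow_ne_zero 2 ((map_ne_zero κ).2 hi)
      have h4 := mul_right_cancel₀ hτ h3
      have h5 := add_left_cancel h4
      have h2 : (2 : AlgebraicClosure ℂ⸨X⸩) ≠ 0 := by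
        rw [← map_ofNat κ 2]; exact (map_ne_zero κ).2 two_ne_zero
      exact (mul_left_cancel₀ h2 h5).symm
    have hbc : b = PowerSeries.C c := hinj hγb
    have hb' : PowerSeries.constantCoeff b = 0 := hb
    rw [hbc, PowerSeries.constantCoeff_C] at hb'
    rw [hbc, hb', map_zero]
  have hdd : pushforward γ (dDef lam mu b) = pushforward κ (dFam lam mu) := by
    rw [← dDef_zero, pushforward_dDef_ringHom, pushforward_dDef_ringHom, hb0, map_zero, map_zero]
    rfl
  rw [hdd] at hK
  exact hne (equivalent_of_equivalent_pushforward κ hK)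

end Deformations

end LieDeform

theorem mainTheorem3 (lam mu : ℂ) (h : mu ≠ -lam) :
    -- the class of `ψ^{13}_2` is a basis of `H²`, and `H³ = 0`
    LieDeform.IsPrebasisH2 (LieDeform.dFam lam mu) (LieDeform.psi132 ℂ) ∧
    LieDeform.H3Vanishes (LieDeform.dFam lam mu) ∧
    -- over `ℂ[t]/(t²)`, `d(lam : mu) + t ψ^{13}_2` is the universal infinitesimal deformation
    LieDeform.IsUniversalInfinitesimal.{0, u} (LieDeform.dFam lam mu) LieDeform.dualNumberAug
      (LieDeform.dDef lam mu (DualNumber.eps : DualNumber ℂ)) ∧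
    -- over `ℂ[[t]]`, without relations, it is a miniversal deformation
    LieDeform.IsMiniversal.{0, u} (LieDeform.dFam lam mu) LieDeform.powerSeriesAug
      (LieDeform.dDef lam mu (PowerSeries.X : PowerSeries ℂ)) ∧
    -- it is equivalent to `d(α : β)`, for complex `t` as well as for `t` in any `ℂ`-algebra
    (∀ t s : ℂ, s ^ 2 = (lam - mu) ^ 2 + 4 * t →
      LieDeform.Equivalent (LieDeform.dDef lam mu t)
        (LieDeform.dFam ((lam + mu + s) / 2) ((lam + mu - s) / 2))) ∧
    (∀ (A : Type u) [CommRing A] [Algebra ℂ A] (t s : A),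
      s ^ 2 = algebraMap ℂ A ((lam - mu) ^ 2) + 4 * t →
      LieDeform.Equivalent (LieDeform.dDef lam mu t) (LieDeform.dRoots lam mu s)) ∧
    -- deformations move along the family: every formal deformation is one by `b ψ^{13}_2` with
    -- `b ∈ 𝔪`, hence one by members of the family, after adjoining the square root if necessary
    (∀ (B : Type u) [CommRing B] [Algebra ℂ B] (εB : B →ₐ[ℂ] ℂ) (dB : LieDeform.Cochain B 2),
      LieDeform.IsFormalAlgebra εB →
      LieDeform.IsDeformation (LieDeform.dFam lam mu) εB dB →
      ∃ b : B, εB b = 0 ∧ LieDeform.InfEquivalent εB (LieDeform.dDef lam mu b) dB ∧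
        ∃ (C : Type u) (_ : CommRing C) (_ : Algebra ℂ C) (εC : C →ₐ[ℂ] ℂ) (j : B →ₐ[ℂ] C) (s : C),
          LieDeform.IsFormalAlgebra εC ∧ Function.Injective j ∧
          s ^ 2 = algebraMap ℂ C ((lam - mu) ^ 2) + 4 * j b ∧ εC s = lam - mu ∧
          LieDeform.InfEquivalent εC (LieDeform.pushforward (j : B →+* C) dB)
            (LieDeform.dRoots lam mu s)) ∧
    -- different values of the parameter give inequivalent Lie algebras
    (∀ t t' : ℂ, LieDeform.Equivalent (LieDeform.dDef lam mu t) (LieDeform.dDef lam mu t') →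
      t = t') ∧
    -- there are no jump deformations
    (∀ (d' : LieDeform.Cochain ℂ 2) (dt : LieDeform.Cochain (PowerSeries ℂ) 2),
      ¬ LieDeform.IsJumpDeformation (LieDeform.dFam lam mu) d' dt) := by
  have h' : lam + mu ≠ 0 := fun h0 => h (eq_neg_of_add_eq_zero_right h0)
  refine ⟨LieDeform.isPrebasisH2_dFam h', LieDeform.h3Vanishes_dFam h',
    LieDeform.isUniversalInfinitesimal_dDef h', LieDeform.isMiniversal_dDef h', ?_, ?_, ?_, ?_,
    LieDeform.not_isJumpDeformation h'⟩
  · intro t s hs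
    rw [← LieDeform.dRoots_complex]
    exact LieDeform.equivalent_dDef_dRoots hs
  · intro A _ _ t s hs
    exact LieDeform.equivalent_dDef_dRoots hs
  · intro B _ _ εB dB hB hd
    have := hB.isLocalRing
    obtain ⟨b, hb, hbd⟩ := hd.exists_infEquivalent_dDef h'
    obtain ⟨C, _, _, εC, j, s, hC, hj, hεj, hs, hεs⟩ :=
      LieDeform.exists_formal_sqrt hB (lam - mu) hb
    refine ⟨b, hb, hbd, C, inferInstance, inferInstance, εC, j, s, hC, hj, hs, hεs, ?_⟩
    have hmap := hbd.symm.map j hεj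
    rw [LieDeform.pushforward_dDef] at hmap
    exact hmap.trans (LieDeform.infEquivalent_dDef_dRoots hs hεs)
  · intro t t' ht
    exact LieDeform.parameter_eq_of_equivalent h' ht
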